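/- Let $d\ge 3$ be a fixed integer, let $\lambda<d$ be a fixed real number, let $g:\mathbb N\to\mathbb N$ satisfy $g(n)\to\infty$, and let $t\ge 0$ be a fixed integer. A $d$-regular simple graph $G$ on $n$ vertices, with adjacency eigenvalues $d=\lambda_1\ge\lambda_2\ge\dots\ge\lambda_n$, is called an $(n,d,\mu)$ graph if $\mu=\max_{i>1}|\lambda_i|$. A non-backtracking random walk of length $n$ on $G$ from a vertex $w_0$ is a random sequence $(w_0,w_1,\dots,w_n)$ in which, successively, $w_1$ is uniform over the neighbours of $w_0$ and, for $i\ge 2$, $w_i$ is uniform over the neighbours of $w_{i-1}$ other than $w_{i-2}$. Put $$N_t=\bigl|\{v\in V(G): |\{1\le i\le n: w_i=v\}|=t\}\bigr| .$$ Then there are real sequences $\delta(n)\to 0$ and $\eta(n)\to 0$, which depend only on $d,\lambda,g,t$, such that for every $n$, every $(n,d,\mu)$ graph $G$ with $\mu\le\lambda$ whose girth is at least $g(n)$, and every starting vertex $w_0$ of $G$, $$\Pr\left[\,\left|\frac{N_t}{n}-\frac{1}{\mathrm e\,t!}\right|\le \delta(n)\right]\ge 1-\eta(n).$$ That is, $N_t/n=\frac{1}{\mathrm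 e\,t!}+o(1)$ with high probability as $n\to\infty$. -/

import Mathlib

open Filter Topology

universe u

noncomputable section

/-- The real adjacency matrix of a finite simple graph is Hermitian. -/
theorem adjMatrix_real_isHermitian {V : Type u} (G : SimpleGraph V) [DecidableRel G.Adj] :
    (G.adjMatrix ℝ).IsHermitian := by
  rw [Matrix.IsHermitian, Matrix.conjTranspose_eq_transpose_of_trivial]
  exact G.isSymm_adjMatrix

/-- `adjEigenvalue G i` is the `(i+1)`-st largest eigenvalue of the adjacency matrix of `G`,
counted with multiplicity, so that `i = 0` is the trivial eigenvalue of a regular graph. -/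
def adjEigenvalue {V : Type u} [Fintype V] [DecidableEq V] (G : SimpleGraph V) [DecidableRel G.Adj]
    (i : Fin (Fintype.card V)) : ℝ :=
  (adjMatrix_real_isHermitian G).eigenvalues₀ i

/-- `G` is an `(n, d, μ)` graph: a `d`-regular graph on `n` vertices whose largest non-trivial
eigenvalue in absolute value is `μ`. -/
structure IsNDLambda {V : Type u} [Fintype V] [DecidableEq V] (G : SimpleGraph V)
    [DecidableRel G.Adj] (n d : ℕ) (μ : ℝ) : Prop where
  card_eq : Fintype.card V = n
  regular : G.IsRegularOfDegree d
  eigenvalue : IsGreatest {x : ℝ | ∃ i : Fin (Fintype.card V), 0 < (i : ℕ) ∧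
    x = |adjEigenvalue G i|} μ

/-- The vertices that may follow the path `w = (w₀, …, w_k)` in a non-backtracking walk:
the neighbours of `w_k`, excluding `w_{k-1}` if `k ≥ 1`. -/
def nbChoices {V : Type u} [Fintype V] [DecidableEq V] (G : SimpleGraph V)
    [DecidableRel G.Adj] {k : ℕ} (w : Fin (k + 1) → V) : Finset V :=
  (G.neighborFinset (w (Fin.last k))).filter
    (fun v => ∀ i : Fin (k + 1), (i : ℕ) + 1 = k → v ≠ w i)

/-- The law of the next vertex: uniform over `nbChoices`. If there is no choice (impossible when
all degrees are at least `2`), the walk stays where it is. -/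
def nbStep {V : Type u} [Fintype V] [DecidableEq V] (G : SimpleGraph V)
    [DecidableRel G.Adj] {k : ℕ} (w : Fin (k + 1) → V) : PMF V :=
  if h : (nbChoices G w).Nonempty then PMF.uniformOfFinset (nbChoices G w) h
  else PMF.pure (w (Fin.last k))

/-- The law of the non-backtracking random walk `(w₀, w₁, …, w_k)` of length `k` from `w₀`. -/
def nbWalk {V : Type u} [Fintype V] [DecidableEq V] (G : SimpleGraph V)
    [DecidableRel G.Adj] (w₀ : V) : (k : ℕ) → PMF (Fin (k + 1) → V)
  | 0 => PMF.pure (fun _ => w₀)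
  | k + 1 => (nbWalk G w₀ k).bind fun w =>
      (nbStep G w).map fun v => (Fin.snoc w v : Fin (k + 1 + 1) → V)

/-- The number of `i` with `1 ≤ i ≤ k` and `w_i = v`. -/
def numVisits {V : Type u} [DecidableEq V] {k : ℕ} (w : Fin (k + 1) → V) (v : V) : ℕ :=
  (Finset.univ.filter fun i : Fin (k + 1) => 1 ≤ (i : ℕ) ∧ w i = v).card

/-- `N_t`: the number of vertices visited precisely `t` times by `w`. -/
def numVisitedExactly {V : Type u} [Fintype V] [DecidableEq V] {k : ℕ}
    (w : Fin (k + 1) → V) (t : ℕ) : ℕ :=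
  (Finset.univ.filter fun v : V => numVisits w v = t).card

/-- The probability of the event `s` under the discrete law `p`. -/
def pmfProb {α : Type*} (p : PMF α) (s : Set α) : ℝ := (p.toOuterMeasure s).toReal

end

set_option linter.unusedSectionVars false

/-! If each new vertex were uniform, the expected fraction of vertices visited `t` times after `i`
steps would be the binomial probability with success rate `1 / n`, which at `i = n` tends to the
Poisson(1) weight `1 / (e t!)`. The actual fraction obeys the same recursion in `t` and `i`, driven
by the `discrepancy`: the indicator that the new vertex had exactly `t` earlier visits, minus the
fraction of such vertices. It suffices that the discrepancies along the walk sum to `o(n)` in mean.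

Single discrepancies need not be small, but each is almost uncorrelated with the history `K + 1`
steps earlier, where `K = √n` (`abs_histExp_discrepancy_le`). Freeze the visit counts at that time.
The spectral gap makes the non-backtracking operator on directed edges contract mean-zero functions
exponentially (`exists_abs_edgeOp_iterate_le`), so the new vertex is nearly uniform against the
frozen counts. Freezing matters only if the new vertex was visited in the last `K` steps, up to `K /
n` from the change of the fraction. Returns in fewer than `g(n)` steps are impossible by the girth,
and a return after `m` steps has probability at most `1 / n + C ρ ^ m √d`; these sum to `o(1)`.

Hence the sum of discrepancies has second moment `o(n²)` (`histExp_discSum_sq_le`). A discrete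
Gronwall argument, by induction on `t`, bounds the mean deviation from the binomial probability
(`histExp_abs_visitDev_le`), and Markov's inequality concludes. -/

noncomputable section

/-! ### Spectral gap of the adjacency operator. -/

section Spectral

variable {V : Type u} [Fintype V] [DecidableEq V] (G : SimpleGraph V) [DecidableRel G.Adj]

/-- On functions of mean zero, the adjacency operator of an `(n, d, μ)` graph with `μ < d` has norm
at most `μ`. -/
theorem sum_sq_neighbor_sum_le {n d : ℕ} {μ : ℝ} (hG : IsNDLambda G n d μ) (hμ : μ < d)
    (m : V → ℝ) (hm : ∑ v, m v = 0) :
    ∑ v, (∑ b ∈ G.neighborFinset v, m b) ^ 2 ≤ μ ^ 2 * ∑ v, m v ^ 2 := by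
  classical
  set hA := adjMatrix_real_isHermitian G
  set A := G.adjMatrix ℝ with hAd
  set b := hA.eigenvectorBasis with hb
  have hsym : A.transpose = A := SimpleGraph.transpose_adjMatrix G
  have hcoef : ∀ (x : V → ℝ) (i : V), ⇑(b i) ⬝ᵥ (A.mulVec x) = hA.eigenvalues i * (⇑(b i) ⬝ᵥ x) := by
    intro x i
    rw [Matrix.dotProduct_mulVec, ← Matrix.mulVec_transpose, hsym, hA.mulVec_eigenvectorBasis i,
      smul_dotProduct, smul_eq_mul]
  have hinner : ∀ (x : V → ℝ) (i : V), inner ℝ (b i) (WithLp.toLp 2 x) = ⇑(b i) ⬝ᵥ x := by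
    intro x i
    simp [PiLp.inner_apply, dotProduct, mul_comm]
  have hpars : ∀ x : V → ℝ, ∑ v, x v ^ 2 = ∑ i, (⇑(b i) ⬝ᵥ x) ^ 2 := by
    intro x
    have h := b.sum_sq_norm_inner_right (WithLp.toLp 2 x)
    rw [EuclideanSpace.norm_sq_eq] at h
    simp only [hinner, Real.norm_eq_abs, sq_abs] at h
    exact h.symm
  have hone : A.mulVec (fun _ => (1 : ℝ)) = fun _ => (d : ℝ) := by
    ext v
    rw [hAd, SimpleGraph.adjMatrix_mulVec_apply]
    simp [hG.regular.degree_eq v]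
  have hev : ∀ i : V, 0 < (((Fintype.equivOfCardEq (Fintype.card_fin _)).symm i :
      Fin (Fintype.card V)) : ℕ) → |hA.eigenvalues i| ≤ μ := fun i hi =>
    hG.eigenvalue.2 ⟨_, hi, rfl⟩
  -- Constants are `d`-eigenvectors, hence orthogonal to every non-top eigenvector, whose eigenvalue
  -- is below `d`. By Parseval they lie along the top eigenvector, so mean zero kills that
  -- coefficient.
  have hz : ∀ i : V, ⇑(b i) ⬝ᵥ m = 0 ∨ |hA.eigenvalues i| ≤ μ := by
    intro i
    by_cases hi : 0 < (((Fintype.equivOfCardEq (Fintype.card_fin _)).symm i :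
      Fin (Fintype.card V)) : ℕ)
    · exact Or.inr (hev i hi)
    left
    have hother : ∀ j, j ≠ i → ⇑(b j) ⬝ᵥ (fun _ => (1 : ℝ)) = 0 := by
      intro j hj
      have hjpos : 0 < (((Fintype.equivOfCardEq (Fintype.card_fin _)).symm j :
          Fin (Fintype.card V)) : ℕ) := by
        by_contra hj0
        apply hj
        apply (Fintype.equivOfCardEq (Fintype.card_fin (Fintype.card V))).symm.injective
        apply Fin.ext
        omega
      have h1 := hcoef (fun _ => 1) j
      rw [hone] at h1
      have h2 : ⇑(b j) ⬝ᵥ (fun _ => (d : ℝ)) = d * (⇑(b j) ⬝ᵥ (fun _ => (1 : ℝ))) := by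
        simp [dotProduct, Finset.mul_sum, mul_comm]
      rw [h2] at h1
      have h3 := (abs_le.1 (hev j hjpos)).2
      have h4 : ((d : ℝ) - hA.eigenvalues j) * (⇑(b j) ⬝ᵥ (fun _ => (1 : ℝ))) = 0 := by
        linarith
      rcases mul_eq_zero.1 h4 with h5 | h5
      · linarith
      · exact h5
    have hbi : ∑ j, (⇑(b j) ⬝ᵥ (fun _ => (1 : ℝ))) * (⇑(b j) ⬝ᵥ m) = ∑ v, m v := by
      have h := b.sum_inner_mul_inner (WithLp.toLp 2 (fun _ => (1 : ℝ))) (WithLp.toLp 2 m)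
      have h6 : inner ℝ (WithLp.toLp 2 (fun _ : V => (1 : ℝ))) (WithLp.toLp 2 m) = ∑ v, m v := by
        simp [PiLp.inner_apply]
      rw [h6] at h
      rw [← h]
      refine Finset.sum_congr rfl fun j _ => ?_
      rw [hinner, real_inner_comm, hinner]
    rw [hm, Finset.sum_eq_single i (fun j _ hj => by rw [hother j hj, zero_mul])
      (fun h => absurd (Finset.mem_univ i) h)] at hbi
    rcases mul_eq_zero.1 hbi with h5 | h5
    · exfalso
      have h7 := hpars (fun _ => 1)
      have h8 : ∑ j, (⇑(b j) ⬝ᵥ (fun _ => (1 : ℝ))) ^ 2 = 0 := by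
        refine Finset.sum_eq_zero fun j _ => ?_
        by_cases hj : j = i
        · rw [hj, h5]; norm_num
        · rw [hother j hj]; norm_num
      rw [h8] at h7
      have : Nonempty V := ⟨i⟩
      simp at h7
    · exact h5
  have hmul : ∀ v, ∑ c ∈ G.neighborFinset v, m c = A.mulVec m v := by
    intro v
    rw [hAd, SimpleGraph.adjMatrix_mulVec_apply]
  simp only [hmul]
  rw [hpars (A.mulVec m), hpars m, Finset.mul_sum]
  refine Finset.sum_le_sum fun i _ => ?_
  rw [hcoef, mul_pow]
  rcases hz i with h | h
  · rw [h]; simp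
  · exact mul_le_mul_of_nonneg_right (sq_le_sq' (abs_le.1 h).1 (abs_le.1 h).2) (sq_nonneg _)

end Spectral

/-! ### Contraction of the non-backtracking operator on directed edges. -/

section EdgeOperator

variable {V : Type u} [Fintype V] [DecidableEq V] (G : SimpleGraph V) [DecidableRel G.Adj]

/-- The transition operator of the non-backtracking walk on functions of directed edges. -/
def edgeOp (q : ℝ) (F : V → V → ℝ) : V → V → ℝ :=
  fun a b => (∑ c ∈ (G.neighborFinset b).erase a, F b c) / q

/-- The sum of a function over all directed edges. -/
def edgeSum (F : V → V → ℝ) : ℝ := ∑ a, ∑ b ∈ G.neighborFinset a, F a b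

/-- The squared `ℓ²` norm over directed edges. -/
def edgeSq (F : V → V → ℝ) : ℝ := edgeSum G fun a b => F a b ^ 2

theorem edgeSum_swap (F : V → V → ℝ) : edgeSum G (fun a b => F b a) = edgeSum G F := by
  unfold edgeSum
  refine Finset.sum_comm' fun a b => ?_
  simp [G.adj_comm]

theorem edgeSum_congr {F F' : V → V → ℝ} (h : ∀ a b, G.Adj a b → F a b = F' a b) :
    edgeSum G F = edgeSum G F' :=
  Finset.sum_congr rfl fun a _ => Finset.sum_congr rfl fun b hb => h a b (by simpa using hb)

theorem edgeSum_nonneg {F : V → V → ℝ} (h : ∀ a b, G.Adj a b → 0 ≤ F a b) : 0 ≤ edgeSum G F :=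
  Finset.sum_nonneg fun a _ => Finset.sum_nonneg fun b hb => h a b (by simpa using hb)

theorem sq_le_edgeSq (F : V → V → ℝ) {a b : V} (h : G.Adj a b) : F a b ^ 2 ≤ edgeSq G F := by
  refine le_trans ?_ (Finset.single_le_sum
    (f := fun a => ∑ b ∈ G.neighborFinset a, F a b ^ 2)
    (fun a _ => Finset.sum_nonneg fun b _ => sq_nonneg _) (Finset.mem_univ a))
  exact Finset.single_le_sum (f := fun b => F a b ^ 2) (fun b _ => sq_nonneg _) (by simpa using h)

/-- The sum of an edge function over the out-edges at a vertex. -/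
def outSum (F : V → V → ℝ) (a : V) : ℝ := ∑ b ∈ G.neighborFinset a, F a b

theorem edgeOp_apply (q : ℝ) (F : V → V → ℝ) {a b : V} (h : G.Adj a b) :
    edgeOp G q F a b = (outSum G F b - F b a) / q := by
  unfold edgeOp outSum
  rw [← Finset.add_sum_erase (G.neighborFinset b) (F b) (by simpa using h.symm)]
  congr 1; ring

variable {G} {d : ℕ} (hreg : G.IsRegularOfDegree d)

include hreg

theorem edgeSum_fst (f : V → ℝ) : edgeSum G (fun a _ => f a) = d * ∑ a, f a := by
  unfold edgeSum
  simp only [Finset.sum_const, SimpleGraph.card_neighborFinset_eq_degree, hreg.degree_eq,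
    nsmul_eq_mul, Finset.mul_sum]

theorem edgeSum_edgeOp (hd : 3 ≤ d) (F : V → V → ℝ) :
    edgeSum G (edgeOp G (d - 1) F) = edgeSum G F := by
  have hd' : (3 : ℝ) ≤ d := by exact_mod_cast hd
  have h1 : edgeSum G (edgeOp G (d - 1) F) =
      edgeSum G (fun a b => (outSum G F a - F a b) / ((d : ℝ) - 1)) := by
    rw [← edgeSum_swap]
    exact edgeSum_congr G fun a b h => edgeOp_apply G _ F h.symm
  have h2 : edgeSum G (fun a b => (outSum G F a - F a b) / ((d : ℝ) - 1)) =
      (edgeSum G (fun a _ => outSum G F a) - edgeSum G F) / ((d : ℝ) - 1) := by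
    simp only [edgeSum, ← Finset.sum_div, Finset.sum_sub_distrib]
  rw [h1, h2, edgeSum_fst hreg]
  have h3 : ∑ a, outSum G F a = edgeSum G F := rfl
  rw [h3]
  field_simp [show (d : ℝ) - 1 ≠ 0 by linarith]

/-- After edge reversal the new value is `(outSum - F) / (d - 1)`, and the cross term of its square
again sums to squared out-sums. Thus the out-average part of `F` keeps its norm, while the
orthogonal part has its squared norm divided by `(d - 1) ^ 2`. -/
theorem edgeSq_edgeOp (hd : 3 ≤ d) (F : V → V → ℝ) :
    edgeSq G (edgeOp G (d - 1) F) =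
      ((d - 2) * ∑ a, outSum G F a ^ 2 + edgeSq G F) / ((d : ℝ) - 1) ^ 2 := by
  have hd' : (3 : ℝ) ≤ d := by exact_mod_cast hd
  have h1 : edgeSq G (edgeOp G (d - 1) F) =
      edgeSum G (fun a b => ((outSum G F a - F a b) / ((d : ℝ) - 1)) ^ 2) := by
    unfold edgeSq
    rw [← edgeSum_swap]
    exact edgeSum_congr G fun a b h => by rw [edgeOp_apply G _ F h.symm]
  have h2 : edgeSum G (fun a b => ((outSum G F a - F a b) / ((d : ℝ) - 1)) ^ 2) =
      (edgeSum G (fun a _ => outSum G F a ^ 2) - 2 * (∑ a, outSum G F a * outSum G F a)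
        + edgeSq G F) / ((d : ℝ) - 1) ^ 2 := by
    have : ∀ a, outSum G F a * outSum G F a = ∑ b ∈ G.neighborFinset a, outSum G F a * F a b := by
      intro a; rw [← Finset.mul_sum]; rfl
    simp only [this]
    simp only [edgeSum, edgeSq, Finset.mul_sum, ← Finset.sum_sub_distrib,
      ← Finset.sum_add_distrib, Finset.sum_div]
    refine Finset.sum_congr rfl fun a _ => Finset.sum_congr rfl fun b _ => ?_
    rw [div_pow]
    ring
  rw [h1, h2, edgeSum_fst hreg]
  simp only [← pow_two]
  congr 1; ring

/-- The out-edge average has smaller norm. -/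
theorem sum_outSum_sq_le (F : V → V → ℝ) : ∑ a, outSum G F a ^ 2 ≤ d * edgeSq G F := by
  unfold edgeSq edgeSum
  rw [Finset.mul_sum]
  refine Finset.sum_le_sum fun a _ => ?_
  have := sq_sum_le_card_mul_sum_sq (s := G.neighborFinset a) (f := F a)
  rwa [SimpleGraph.card_neighborFinset_eq_degree, hreg.degree_eq] at this

theorem edgeSq_edgeOp_le (hd : 3 ≤ d) (F : V → V → ℝ) :
    edgeSq G (edgeOp G (d - 1) F) ≤ edgeSq G F := by
  have hd' : (3 : ℝ) ≤ d := by exact_mod_cast hd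
  have h := sum_outSum_sq_le hreg F
  rw [edgeSq_edgeOp hreg hd, div_le_iff₀ (by nlinarith)]
  nlinarith [mul_le_mul_of_nonneg_left h (show (0 : ℝ) ≤ d - 2 by linarith)]

/-- The squared norm of the out-sums after one step, when the adjacency operator contracts. -/
theorem sum_outSum_edgeOp_sq_le (hd : 3 ≤ d) {lam : ℝ}
    (hA : ∀ m : V → ℝ, ∑ v, m v = 0 →
      ∑ v, (∑ b ∈ G.neighborFinset v, m b) ^ 2 ≤ lam ^ 2 * ∑ v, m v ^ 2)
    (F : V → V → ℝ) (hF : edgeSum G F = 0) {s : ℝ} (hs : 0 < s) :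
    ∑ a, outSum G (edgeOp G (d - 1) F) a ^ 2 ≤
      (1 + s) * (lam / d) ^ 2 * ∑ a, outSum G F a ^ 2 +
        (1 + 1 / s) * (d / ((d : ℝ) - 1) ^ 2) * (edgeSq G F - (∑ a, outSum G F a ^ 2) / d) := by
  have hd' : (3 : ℝ) ≤ d := by exact_mod_cast hd
  have hd0 : (d : ℝ) ≠ 0 := by positivity
  have hq0 : (d : ℝ) - 1 ≠ 0 := by linarith
  set m : V → ℝ := fun a => outSum G F a / d with hm
  have hm0 : ∑ v, m v = 0 := by
    rw [hm, ← Finset.sum_div]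
    have : ∑ a, outSum G F a = edgeSum G F := rfl
    rw [this, hF, zero_div]
  set z : V → ℝ := fun a => ∑ b ∈ G.neighborFinset a, (F b a - m b) with hz
  -- The out-averages `m` are moved by the adjacency operator; the fluctuation around them enters
  -- through reversed edges, with factor `1 / (d - 1)`.
  have key : ∀ a, outSum G (edgeOp G (d - 1) F) a =
      (∑ b ∈ G.neighborFinset a, m b) - z a / (d - 1) := by
    intro a
    rw [hz]
    simp only [Finset.sum_div]
    rw [← Finset.sum_sub_distrib]
    unfold outSum
    refine Finset.sum_congr rfl fun b hb => ?_
    rw [edgeOp_apply G _ F (by simpa using hb)]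
    simp only [hm]
    field_simp
    ring
  -- Reversal preserves the norm, and Pythagoras gives the norm of the fluctuation.
  have hz2 : ∑ a, z a ^ 2 ≤ d * (edgeSq G F - (∑ a, outSum G F a ^ 2) / d) := by
    have h1 : ∑ a, z a ^ 2 ≤ d * edgeSq G (fun a b => F b a - m b) :=
      sum_outSum_sq_le hreg (fun a b => F b a - m b)
    have h2 : edgeSq G (fun a b => F b a - m b) = edgeSq G (fun a b => F a b - m a) :=
      edgeSum_swap G (fun a b => (F a b - m a) ^ 2)
    have h3 : edgeSq G (fun a b => F a b - m a) =
        edgeSum G (fun a _ => m a ^ 2) - 2 * (∑ a, m a * outSum G F a) + edgeSq G F := by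
      have : ∀ a, m a * outSum G F a = ∑ b ∈ G.neighborFinset a, m a * F a b := by
        intro a; rw [← Finset.mul_sum]; rfl
      simp only [this]
      simp only [edgeSum, edgeSq, Finset.mul_sum, ← Finset.sum_sub_distrib,
        ← Finset.sum_add_distrib]
      refine Finset.sum_congr rfl fun a _ => Finset.sum_congr rfl fun b _ => ?_
      ring
    have h4 : edgeSq G (fun a b => F a b - m a) = edgeSq G F - (∑ a, outSum G F a ^ 2) / d := by
      rw [h3, edgeSum_fst hreg]
      have e1 : ∑ a, m a ^ 2 = (∑ a, outSum G F a ^ 2) / d ^ 2 := by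
        rw [Finset.sum_div]; exact Finset.sum_congr rfl fun a _ => div_pow _ _ _
      have e2 : ∑ a, m a * outSum G F a = (∑ a, outSum G F a ^ 2) / d := by
        rw [Finset.sum_div]
        exact Finset.sum_congr rfl fun a _ => by simp only [hm]; ring
      rw [e1, e2]
      field_simp
      ring
    rw [h2, h4] at h1
    exact h1
  have hA' := hA m hm0
  have e1 : ∑ a, m a ^ 2 = (∑ a, outSum G F a ^ 2) / d ^ 2 := by
    rw [Finset.sum_div]; exact Finset.sum_congr rfl fun a _ => div_pow _ _ _
  have young : ∀ x y : ℝ, (x - y) ^ 2 ≤ (1 + s) * x ^ 2 + (1 + 1 / s) * y ^ 2 := by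
    intro x y
    have h : (1 + s) * x ^ 2 + (1 + 1 / s) * y ^ 2 - (x - y) ^ 2 = (s * x + y) ^ 2 / s := by
      field_simp; ring
    have : 0 ≤ (s * x + y) ^ 2 / s := by positivity
    linarith
  calc ∑ a, outSum G (edgeOp G (d - 1) F) a ^ 2
      ≤ ∑ a, ((1 + s) * (∑ b ∈ G.neighborFinset a, m b) ^ 2
          + (1 + 1 / s) * (z a / (d - 1)) ^ 2) :=
        Finset.sum_le_sum fun a _ => by rw [key a]; exact young _ _
    _ = (1 + s) * ∑ a, (∑ b ∈ G.neighborFinset a, m b) ^ 2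
          + (1 + 1 / s) / (d - 1) ^ 2 * ∑ a, z a ^ 2 := by
        rw [Finset.sum_add_distrib, Finset.mul_sum, Finset.mul_sum]
        congr 1
        refine Finset.sum_congr rfl fun a _ => ?_
        rw [div_pow]; ring
    _ ≤ (1 + s) * (lam ^ 2 * ((∑ a, outSum G F a ^ 2) / d ^ 2))
          + (1 + 1 / s) / (d - 1) ^ 2 * (d * (edgeSq G F - (∑ a, outSum G F a ^ 2) / d)) := by
        rw [e1] at hA'
        gcongr
    _ = _ := by
        rw [div_pow]; ring

omit hreg

/-- Two steps of the edge operator contract mean-zero functions, at a rate that depends only on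
the degree and the spectral bound. -/
theorem exists_edgeSq_edgeOp_edgeOp_le (d : ℕ) (hd : 3 ≤ d) (lam : ℝ) (h0 : 0 ≤ lam)
    (hlam : lam < d) :
    ∃ c : ℝ, 0 < c ∧ c < 1 ∧ ∀ (V : Type u) [Fintype V] [DecidableEq V] (G : SimpleGraph V)
      [DecidableRel G.Adj], G.IsRegularOfDegree d →
      (∀ m : V → ℝ, ∑ v, m v = 0 →
        ∑ v, (∑ b ∈ G.neighborFinset v, m b) ^ 2 ≤ lam ^ 2 * ∑ v, m v ^ 2) →
      ∀ F : V → V → ℝ, edgeSum G F = 0 →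
        edgeSq G (edgeOp G (d - 1) (edgeOp G (d - 1) F)) ≤ c * edgeSq G F := by
  have hd' : (3 : ℝ) ≤ d := by exact_mod_cast hd
  set l : ℝ := lam / d with hl
  have hl0 : 0 ≤ l := by positivity
  have hl1 : l < 1 := (div_lt_one (by linarith)).2 hlam
  -- The Young weight, small enough that `(1 + s) * l ^ 2 < 1`.
  set s : ℝ := (1 - l ^ 2) / 2 with hs
  have hs0 : 0 < s := by rw [hs]; nlinarith
  set β : ℝ := (1 + s) * l ^ 2 with hβ
  have hβ0 : 0 ≤ β := by positivity
  have hβ1 : β < 1 := by rw [hβ, hs]; nlinarith [sq_nonneg l, pow_le_one₀ hl0 hl1.le (n := 2)]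
  set γ : ℝ := (1 + 1 / s) with hγ
  have hγ1 : 1 < γ := by rw [hγ]; have : 0 < 1 / s := by positivity
                         linarith
  -- Weight for interpolating the two bounds on `Z` below: the spectral one gains on `X` but may
  -- lose a factor `γ` on `Y`, and `τ * γ = 1 / 4` keeps the coefficient of `Y` below `1 / 2`.
  set τ : ℝ := 1 / (4 * γ) with hτ
  have hτ0 : 0 < τ := by positivity
  have hτ1 : τ < 1 := by rw [hτ, div_lt_one (by linarith)]; linarith
  have hτγ : τ * γ = 1 / 4 := by rw [hτ]; field_simp
  set c' : ℝ := max (1 - τ * (1 - β)) (1 / 2) with hc'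
  have hc'1 : c' < 1 := by
    rw [hc']; refine max_lt ?_ (by norm_num)
    nlinarith
  have hc'0 : 1 / 2 ≤ c' := le_max_right _ _
  set q : ℝ := (d : ℝ) - 1 with hq
  have hq2 : 2 ≤ q := by rw [hq]; linarith
  have hq4 : 4 ≤ q ^ 2 := by nlinarith
  refine ⟨(1 - 1 / q ^ 2) * c' + 1 / q ^ 2, ?_, ?_, ?_⟩
  · have : 1 / q ^ 2 ≤ 1 := by rw [div_le_one (by positivity)]; linarith
    have h2 : 0 < 1 / q ^ 2 := by positivity
    nlinarith
  · have : 1 / q ^ 2 < 1 := by rw [div_lt_one (by positivity)]; linarith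
    nlinarith
  · intro V _ _ G _ hreg hA F hF
    -- `X` and `Y` are the squared norms of the out-average part of `F` and of its complement. One
    -- step need not shrink `X`, which is why two steps are taken.
    set X : ℝ := (∑ a, outSum G F a ^ 2) / d with hX
    have hX0 : 0 ≤ X := by positivity
    set Y : ℝ := edgeSq G F - X with hY
    have hd0 : (d : ℝ) ≠ 0 := by linarith
    have hXd : ∑ a, outSum G F a ^ 2 = d * X := by rw [hX]; field_simp
    have hY0 : 0 ≤ Y := by
      have := sum_outSum_sq_le hreg F
      rw [hXd] at this
      rw [hY]
      have := le_of_mul_le_mul_left this (by linarith : (0 : ℝ) < d)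
      linarith
    have hQ : edgeSq G F = X + Y := by rw [hY]; ring
    have hQ1 : edgeSq G (edgeOp G q F) = X + Y / q ^ 2 := by
      rw [hq, edgeSq_edgeOp hreg hd, hXd, hQ, ← hq]
      have : (d : ℝ) = q + 1 := by rw [hq]; ring
      rw [this]; field_simp; ring
    set Z : ℝ := (∑ a, outSum G (edgeOp G q F) a ^ 2) / d with hZ
    have hZd : ∑ a, outSum G (edgeOp G q F) a ^ 2 = d * Z := by rw [hZ]; field_simp
    have hZ1 : Z ≤ X + Y / q ^ 2 := by
      have := sum_outSum_sq_le hreg (edgeOp G q F)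
      rw [hZd, hQ1] at this
      exact le_of_mul_le_mul_left this (by linarith)
    have hZ2 : Z ≤ β * X + γ * Y / q ^ 2 := by
      have := sum_outSum_edgeOp_sq_le hreg hd hA F hF hs0
      rw [← hq, hZd, ← hX, hXd, ← hY] at this
      refine le_of_mul_le_mul_left (this.trans (le_of_eq ?_)) (by linarith : (0 : ℝ) < d)
      rw [hβ, hγ, hl]; ring
    have hYq : Y / q ^ 2 ≤ Y / 4 := by gcongr
    have hYq0 : 0 ≤ Y / q ^ 2 := by positivity
    have hZ3 : Z ≤ c' * (X + Y) := by
      have h1 : Z ≤ (1 - τ * (1 - β)) * X + 1 / 2 * Y := by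
        have h2 : Z ≤ τ * (β * X + γ * Y / q ^ 2) + (1 - τ) * (X + Y / q ^ 2) := by
          have h21 := mul_le_mul_of_nonneg_left hZ2 hτ0.le
          have h22 := mul_le_mul_of_nonneg_left hZ1 (sub_nonneg.2 hτ1.le)
          linarith
        have h3 : τ * (γ * Y / q ^ 2) = 1 / 4 * (Y / q ^ 2) := by rw [← hτγ]; ring
        have h4 : (1 - τ) * (Y / q ^ 2) ≤ Y / q ^ 2 :=
          mul_le_of_le_one_left hYq0 (by linarith)
        linarith
      have h5 := mul_le_mul_of_nonneg_right (le_max_left (1 - τ * (1 - β)) (1 / 2)) hX0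
      have h6 := mul_le_mul_of_nonneg_right hc'0 hY0
      rw [← hc'] at h5
      linarith
    have hfin : edgeSq G (edgeOp G q (edgeOp G q F)) =
        (1 - 1 / q ^ 2) * Z + (X + Y / q ^ 2) / q ^ 2 := by
      conv_lhs => rw [hq]
      rw [edgeSq_edgeOp hreg hd, ← hq, hZd, hQ1]
      have : (d : ℝ) = q + 1 := by rw [hq]; ring
      rw [this]; field_simp; ring
    rw [hfin, hQ, add_mul]
    have hone : 1 / q ^ 2 ≤ 1 := by rw [div_le_one (by positivity)]; linarith
    have h7 : (1 - 1 / q ^ 2) * Z ≤ (1 - 1 / q ^ 2) * c' * (X + Y) := by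
      rw [mul_assoc]; exact mul_le_mul_of_nonneg_left hZ3 (by linarith)
    have h8 : (X + Y / q ^ 2) / q ^ 2 ≤ 1 / q ^ 2 * (X + Y) := by
      rw [div_mul_eq_mul_div, one_mul]
      gcongr
      linarith
    linarith

/-- Exponential decay of the iterated edge operator on mean-zero functions. -/
theorem exists_abs_edgeOp_iterate_le (d : ℕ) (hd : 3 ≤ d) (lam : ℝ) (h0 : 0 ≤ lam)
    (hlam : lam < d) :
    ∃ C ρ : ℝ, 0 < C ∧ 0 < ρ ∧ ρ < 1 ∧ ∀ (V : Type u) [Fintype V] [DecidableEq V]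
      (G : SimpleGraph V) [DecidableRel G.Adj], G.IsRegularOfDegree d →
      (∀ m : V → ℝ, ∑ v, m v = 0 →
        ∑ v, (∑ b ∈ G.neighborFinset v, m b) ^ 2 ≤ lam ^ 2 * ∑ v, m v ^ 2) →
      ∀ F : V → V → ℝ, edgeSum G F = 0 → ∀ (k : ℕ) (a b : V), G.Adj a b →
        |(edgeOp G (d - 1))^[k] F a b| ≤ C * ρ ^ k * √(edgeSq G F) := by
  obtain ⟨c, hc0, hc1, hc⟩ := exists_edgeSq_edgeOp_edgeOp_le.{u} d hd lam h0 hlam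
  -- Two steps multiply the squared norm by `c`, so one step costs `c ^ (1 / 4)` in norm; the
  -- constant `1 / ρ` pays for an unpaired step when `k` is odd.
  set ρ : ℝ := √(√c) with hρ
  have hρ0 : 0 < ρ := by positivity
  have hρ4 : ρ ^ 4 = c := by
    rw [show (4 : ℕ) = 2 * 2 from rfl, pow_mul, hρ, Real.sq_sqrt (by positivity),
      Real.sq_sqrt hc0.le]
  have hρ1 : ρ < 1 := by
    by_contra h
    have := one_le_pow₀ (not_lt.1 h) (n := 4)
    linarith
  refine ⟨1 / ρ, ρ, by positivity, hρ0, hρ1, ?_⟩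
  intro V _ _ G _ hreg hA F hF k a b hab
  have hsum : ∀ j, edgeSum G ((edgeOp G ((d : ℝ) - 1))^[j] F) = 0 := by
    intro j
    induction j with
    | zero => exact hF
    | succ j ih => rw [Function.iterate_succ_apply', edgeSum_edgeOp hreg hd, ih]
  have heven : ∀ j, edgeSq G ((edgeOp G ((d : ℝ) - 1))^[2 * j] F) ≤ c ^ j * edgeSq G F := by
    intro j
    induction j with
    | zero => simp
    | succ j ih =>
      rw [show 2 * (j + 1) = (2 * j + 1) + 1 by ring, Function.iterate_succ_apply',
        Function.iterate_succ_apply']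
      refine (hc V G hreg hA _ (hsum _)).trans ?_
      rw [pow_succ', mul_assoc]
      exact mul_le_mul_of_nonneg_left ih hc0.le
  have hQ0 : 0 ≤ edgeSq G F := edgeSum_nonneg G fun _ _ _ => sq_nonneg _
  have hall : edgeSq G ((edgeOp G ((d : ℝ) - 1))^[k] F) ≤ (1 / ρ * ρ ^ k) ^ 2 * edgeSq G F := by
    rcases Nat.even_or_odd' k with ⟨j, rfl | rfl⟩
    · refine (heven j).trans (mul_le_mul_of_nonneg_right ?_ hQ0)
      rw [← hρ4, mul_pow, ← pow_mul, ← pow_mul, show 2 * j * 2 = 4 * j by ring]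
      refine le_mul_of_one_le_left (by positivity) ?_
      exact one_le_pow₀ (by rw [le_div_iff₀ hρ0]; linarith)
    · rw [Function.iterate_succ_apply']
      refine (edgeSq_edgeOp_le hreg hd _).trans ((heven j).trans (le_of_eq ?_))
      rw [← hρ4]
      congr 1
      field_simp
      ring
  have h1 := (sq_le_edgeSq G _ hab).trans hall
  refine abs_le_of_sq_le_sq ?_ (by positivity)
  rw [mul_pow, Real.sq_sqrt hQ0]
  exact h1

end EdgeOperator

/-! ### Closed non-backtracking walks and cycles. -/

section Girth

variable {V : Type u} {G : SimpleGraph V}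

theorem exists_walk_of_adj (m : ℕ) (w : ℕ → V) (hadj : ∀ i < m, G.Adj (w i) (w (i + 1))) :
    ∃ p : G.Walk (w 0) (w m), p.length = m ∧ p.support = (List.range (m + 1)).map w := by
  induction m generalizing w with
  | zero => exact ⟨SimpleGraph.Walk.nil, rfl, by simp⟩
  | succ m ih =>
    obtain ⟨p, hp, hs⟩ := ih (fun i => w (i + 1)) fun i hi => hadj (i + 1) (by omega)
    refine ⟨SimpleGraph.Walk.cons (hadj 0 (by omega)) p, by simp [hp], ?_⟩
    rw [SimpleGraph.Walk.support_cons, hs, List.range_succ_eq_map (n := m + 1)]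
    simp [List.map_map, Function.comp_def]

/-- A closed non-backtracking walk of length `k ≥ 1` forces a cycle of length at most `k`. -/
theorem egirth_le_of_nonbacktracking (k : ℕ) (hk : 1 ≤ k) (w : ℕ → V)
    (hadj : ∀ i < k, G.Adj (w i) (w (i + 1))) (hnb : ∀ i, i + 2 ≤ k → w i ≠ w (i + 2))
    (hclosed : w 0 = w k) : G.egirth ≤ k := by
  induction k using Nat.strong_induction_on generalizing w with
  | _ k ih =>
    -- A proper repetition gives a shorter closed segment, handled by induction; without one the
    -- walk is itself a cycle.
    by_cases hex : ∃ i j, i < j ∧ j ≤ k ∧ j - i < k ∧ w i = w j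
    · obtain ⟨i, j, hij, hjk, hlt, he⟩ := hex
      refine (ih (j - i) hlt (by omega) (fun x => w (i + x)) (fun x hx => hadj (i + x) (by omega))
        (fun x hx => hnb (i + x) (by omega)) ?_).trans (by exact_mod_cast hlt.le)
      simp only [add_zero]
      rw [he]; congr 1; omega
    · push Not at hex
      have hk3 : 3 ≤ k := by
        by_contra h
        interval_cases k
        · have := hadj 0 (by omega)
          rw [hclosed] at this
          exact G.irrefl this
        · exact hnb 0 (by omega) hclosed
      obtain ⟨m, rfl⟩ : ∃ m, k = m + 2 := ⟨k - 2, by omega⟩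
      obtain ⟨p, hp, hs⟩ := exists_walk_of_adj (G := G) m (fun i => w (i + 2))
        fun i hi => hadj (i + 2) (by omega)
      have h01 : G.Adj (w (m + 2)) (w 1) := hclosed ▸ hadj 0 (by omega)
      have h12 : G.Adj (w 1) (w 2) := hadj 1 (by omega)
      have hmem : ∀ x, x ∈ p.support → ∃ i ≤ m, x = w (i + 2) := by
        intro x hx
        rw [hs] at hx
        obtain ⟨i, hi, rfl⟩ := List.mem_map.1 hx
        exact ⟨i, by simpa [Nat.lt_succ_iff] using hi, rfl⟩
      have hw1 : w 1 ∉ p.support := by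
        intro hx
        obtain ⟨i, hi, he⟩ := hmem _ hx
        exact hex 1 (i + 2) (by omega) (by omega) (by omega) he
      have hppath : p.IsPath := by
        rw [SimpleGraph.Walk.isPath_def, hs]
        refine List.Nodup.map_on ?_ List.nodup_range
        intro x hx y hy hxy
        simp only [List.mem_range] at hx hy
        by_contra hne
        rcases lt_or_gt_of_ne hne with h | h
        · exact hex (x + 2) (y + 2) (by omega) (by omega) (by omega) hxy
        · exact hex (y + 2) (x + 2) (by omega) (by omega) (by omega) hxy.symm
      have hcyc : (SimpleGraph.Walk.cons h01 (SimpleGraph.Walk.cons h12 p)).IsCycle := by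
        rw [SimpleGraph.Walk.cons_isCycle_iff]
        refine ⟨hppath.cons hw1, ?_⟩
        rw [SimpleGraph.Walk.edges_cons, List.mem_cons, not_or]
        constructor
        · intro h
          rw [Sym2.eq_iff] at h
          rcases h with ⟨h, -⟩ | ⟨h, -⟩
          · exact hex 1 (m + 2) (by omega) (by omega) (by omega) h.symm
          · exact hnb 0 (by omega) (hclosed.trans h)
        · intro h
          exact hw1 (p.snd_mem_support_of_mem_edges h)
      have := SimpleGraph.egirth_le_length hcyc
      simpa [hp, add_assoc] using this

end Girth

/-! ### Conditional expectations over histories. -/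

section Histories

variable {V : Type u} [Fintype V] [DecidableEq V] (G : SimpleGraph V) [DecidableRel G.Adj]

/-- The vertices that may follow a history, given as the list of visited vertices, latest first. -/
def nextSet : List V → Finset V
  | [] => ∅
  | [b] => G.neighborFinset b
  | b :: a :: _ => (G.neighborFinset b).erase a

/-- Non-backtracking walks, as lists of vertices, latest first. -/
inductive IsHist : List V → Prop
  | single (b : V) : IsHist [b]
  | cons {v : V} {l : List V} : v ∈ nextSet G l → IsHist l → IsHist (v :: l)

/-- The expectation of `f` after one more step of the walk. -/
def stepAvg (f : List V → ℝ) (l : List V) : ℝ :=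
  (∑ v ∈ nextSet G l, f (v :: l)) / (nextSet G l).card

/-- The conditional expectation of `f` given the history, `k` steps earlier. -/
def histExp (k : ℕ) (f : List V → ℝ) : List V → ℝ := (stepAvg G)^[k] f

theorem histExp_zero (f : List V → ℝ) : histExp G 0 f = f := rfl

/-- This form averages out the last step of the walk first; the primed form isolates its first step.
-/
theorem histExp_succ (k : ℕ) (f : List V → ℝ) :
    histExp G (k + 1) f = histExp G k (stepAvg G f) := rfl

theorem histExp_succ' (k : ℕ) (f : List V → ℝ) :
    histExp G (k + 1) f = stepAvg G (histExp G k f) := Function.iterate_succ_apply' _ _ _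

theorem histExp_add_steps (j k : ℕ) (f : List V → ℝ) :
    histExp G (j + k) f = histExp G j (histExp G k f) := Function.iterate_add_apply _ _ _ _

variable {G}

theorem IsHist.ne_nil {l : List V} (h : IsHist G l) : l ≠ [] := by
  cases h <;> simp

theorem IsHist.tail_of_cons {v : V} {l : List V} (h : IsHist G (v :: l)) (hl : l ≠ []) :
    IsHist G l := by
  cases h with
  | single => exact absurd rfl hl
  | cons _ h => exact h

theorem IsHist.adj {a b : V} {r : List V} (h : IsHist G (b :: a :: r)) : G.Adj a b := by
  cases h with
  | cons hv _ =>
    cases r with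
    | nil => simpa [nextSet] using hv
    | cons c r => simpa [nextSet] using (Finset.mem_of_mem_erase hv)

theorem IsHist.ne {a b c : V} {r : List V} (h : IsHist G (c :: b :: a :: r)) : c ≠ a := by
  cases h with
  | cons hv _ => exact Finset.ne_of_mem_erase hv

theorem IsHist.drop {l : List V} (h : IsHist G l) {i : ℕ} (hi : i < l.length) :
    IsHist G (l.drop i) := by
  induction i with
  | zero => simpa using h
  | succ i ih =>
    have h1 := ih (by omega)
    rw [List.drop_eq_getElem_cons (by omega)] at h1
    exact h1.tail_of_cons (by simp; omega)

/-- A repeated vertex in a non-backtracking walk bounds the girth. -/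
theorem IsHist.egirth_le {l : List V} (h : IsHist G l) {m : ℕ} (hm : 1 ≤ m) (hml : m < l.length)
    (he : l[0]? = l[m]?) : G.egirth ≤ m := by
  have h0 : l ≠ [] := h.ne_nil
  have v0 : V := l.head h0
  refine egirth_le_of_nonbacktracking m hm (fun i => l.getD i v0) ?_ ?_ ?_
  · intro i hi
    have h1 := h.drop (i := i) (by omega)
    rw [List.drop_eq_getElem_cons (by omega), List.drop_eq_getElem_cons (by omega)] at h1
    simp only [List.getD_eq_getElem?_getD]
    rw [List.getElem?_eq_getElem (by omega), List.getElem?_eq_getElem (by omega)]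
    exact h1.adj.symm
  · intro i hi
    have h1 := h.drop (i := i) (by omega)
    rw [List.drop_eq_getElem_cons (by omega), List.drop_eq_getElem_cons (by omega),
      List.drop_eq_getElem_cons (by omega)] at h1
    simp only [List.getD_eq_getElem?_getD]
    rw [List.getElem?_eq_getElem (by omega), List.getElem?_eq_getElem (by omega)]
    exact h1.ne
  · simp only [List.getD_eq_getElem?_getD, he]

theorem card_nextSet {d : ℕ} (hreg : G.IsRegularOfDegree d) {a b : V} (h : G.Adj a b)
    (r : List V) : (nextSet G (b :: a :: r)).card = d - 1 := by
  rw [nextSet, Finset.card_erase_of_mem (by simpa using h.symm),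
    SimpleGraph.card_neighborFinset_eq_degree, hreg.degree_eq]

theorem card_nextSet_pos {d : ℕ} (hreg : G.IsRegularOfDegree d) (hd : 3 ≤ d) {l : List V}
    (h : l ≠ []) : 0 < (nextSet G l).card := by
  match l, h with
  | [b], _ =>
    rw [nextSet, SimpleGraph.card_neighborFinset_eq_degree, hreg.degree_eq]; omega
  | b :: a :: r, _ =>
    rw [nextSet]
    have := Finset.pred_card_le_card_erase (s := G.neighborFinset b) (a := a)
    rw [SimpleGraph.card_neighborFinset_eq_degree, hreg.degree_eq] at this
    omega

/-- Only non-backtracking extensions of `l` carry weight. Restricting the comparison to them is what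
lets girth and the known past enter expectations. -/
theorem histExp_mono {k : ℕ} {f g : List V → ℝ} {l : List V} (hl : IsHist G l)
    (h : ∀ L, IsHist G L → L.length = l.length + k → L.drop k = l → f L ≤ g L) :
    histExp G k f l ≤ histExp G k g l := by
  induction k generalizing l with
  | zero => exact h l hl rfl rfl
  | succ k ih =>
    rw [histExp_succ', histExp_succ']
    unfold stepAvg
    refine div_le_div_of_nonneg_right (Finset.sum_le_sum fun v hv => ?_) (Nat.cast_nonneg _)
    refine ih (hl.cons hv) fun L hL hlen hdrop => h L hL ?_ ?_
    · rw [hlen, List.length_cons]; omega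
    · rw [← List.drop_drop, hdrop]; rfl

theorem histExp_congr {k : ℕ} {f g : List V → ℝ} {l : List V} (hl : IsHist G l)
    (h : ∀ L, IsHist G L → L.length = l.length + k → L.drop k = l → f L = g L) :
    histExp G k f l = histExp G k g l :=
  le_antisymm (histExp_mono hl fun L h1 h2 h3 => (h L h1 h2 h3).le)
    (histExp_mono hl fun L h1 h2 h3 => (h L h1 h2 h3).ge)

theorem histExp_add (k : ℕ) (f g : List V → ℝ) (l : List V) :
    histExp G k (fun L => f L + g L) l = histExp G k f l + histExp G k g l := by
  induction k generalizing l with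
  | zero => rfl
  | succ k ih =>
    simp only [histExp_succ', stepAvg, ih, Finset.sum_add_distrib, add_div]

theorem histExp_const_mul (k : ℕ) (c : ℝ) (f : List V → ℝ) (l : List V) :
    histExp G k (fun L => c * f L) l = c * histExp G k f l := by
  induction k generalizing l with
  | zero => rfl
  | succ k ih =>
    simp only [histExp_succ', stepAvg, ih, ← Finset.mul_sum, mul_div_assoc]

theorem histExp_sum {ι : Type*} (k : ℕ) (s : Finset ι) (f : ι → List V → ℝ) (l : List V) :
    histExp G k (fun L => ∑ i ∈ s, f i L) l = ∑ i ∈ s, histExp G k (f i) l := by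
  induction k generalizing l with
  | zero => rfl
  | succ k ih =>
    simp only [histExp_succ', stepAvg, ih]
    rw [Finset.sum_comm, Finset.sum_div]

theorem histExp_const {d : ℕ} (hreg : G.IsRegularOfDegree d) (hd : 3 ≤ d) (k : ℕ) (c : ℝ)
    {l : List V} (hl : l ≠ []) : histExp G k (fun _ => c) l = c := by
  induction k generalizing l with
  | zero => rfl
  | succ k ih =>
    have h := card_nextSet_pos hreg hd hl
    rw [histExp_succ', stepAvg]
    rw [Finset.sum_congr rfl fun v _ => ih (l := v :: l) (by simp)]
    rw [Finset.sum_const, nsmul_eq_mul]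
    field_simp

theorem abs_histExp_le {k : ℕ} (f : List V → ℝ) {l : List V} (hl : IsHist G l) :
    |histExp G k f l| ≤ histExp G k (fun L => |f L|) l := by
  rw [abs_le]
  constructor
  · have h := histExp_const_mul (G := G) k (-1) (fun L => |f L|) l
    have h2 : histExp G k (fun L => -1 * |f L|) l ≤ histExp G k f l :=
      histExp_mono hl fun L _ _ _ => by linarith [neg_abs_le (f L)]
    linarith
  · exact histExp_mono hl fun L _ _ _ => le_abs_self _

theorem histExp_le_of_le {d : ℕ} (hreg : G.IsRegularOfDegree d) (hd : 3 ≤ d) {k : ℕ}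
    {f : List V → ℝ} {l : List V} (hl : IsHist G l) {c : ℝ}
    (h : ∀ L, IsHist G L → L.length = l.length + k → L.drop k = l → f L ≤ c) :
    histExp G k f l ≤ c :=
  (histExp_mono hl h).trans (histExp_const hreg hd k c hl.ne_nil).le

theorem abs_histExp_le_of_le {d : ℕ} (hreg : G.IsRegularOfDegree d) (hd : 3 ≤ d) {k : ℕ}
    {f : List V → ℝ} {l : List V} (hl : IsHist G l) {c : ℝ}
    (h : ∀ L, IsHist G L → L.length = l.length + k → L.drop k = l → |f L| ≤ c) :
    |histExp G k f l| ≤ c :=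
  (abs_histExp_le f hl).trans (histExp_le_of_le hreg hd hl h)

/-- The function of a history that only looks at the current vertex. -/
def headFun (f : V → ℝ) : List V → ℝ
  | [] => 0
  | v :: _ => f v

/-- The walk is Markov on directed edges. Two past vertices are required because the opening step,
with `d` choices instead of `d - 1`, is not governed by `edgeOp`. -/
theorem histExp_headFun {d : ℕ} (hreg : G.IsRegularOfDegree d) (hd : 3 ≤ d) (f : V → ℝ) (k : ℕ)
    {a b : V} {r : List V} (h : IsHist G (b :: a :: r)) :
    histExp G k (headFun f) (b :: a :: r) =
      (edgeOp G ((d : ℝ) - 1))^[k] (fun _ v => f v) a b := by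
  induction k generalizing a b r with
  | zero => rfl
  | succ k ih =>
    rw [histExp_succ', Function.iterate_succ_apply', stepAvg, card_nextSet hreg h.adj, edgeOp,
      Nat.cast_sub (by omega), Nat.cast_one]
    congr 1
    exact Finset.sum_congr rfl fun v hv => ih (h.cons hv)

end Histories

/-! ### The law of the walk as an iterated one-step average. -/

section Law

variable {V : Type u} [Fintype V] [DecidableEq V] (G : SimpleGraph V) [DecidableRel G.Adj]

/-- A finite path as a history, latest vertex first. -/
def toHist {k : ℕ} (w : Fin (k + 1) → V) : List V := (List.ofFn w).reverse

theorem toHist_snoc {k : ℕ} (w : Fin (k + 1) → V) (v : V) :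
    toHist (Fin.snoc w v : Fin (k + 1 + 1) → V) = v :: toHist w := by
  unfold toHist
  rw [List.ofFn_succ']
  simp

theorem nbChoices_eq_nextSet {k : ℕ} (w : Fin (k + 1) → V) :
    nbChoices G w = nextSet G (toHist w) := by
  cases k with
  | zero =>
    ext v
    simp [nbChoices, toHist, nextSet, Fin.last]
  | succ k =>
    have hw : toHist w = w (Fin.last (k + 1)) :: w (Fin.last k).castSucc ::
        ((List.ofFn fun i : Fin k => w i.castSucc.castSucc).reverse) := by
      unfold toHist
      rw [List.ofFn_succ', List.ofFn_succ']
      simp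
    rw [hw]
    ext v
    simp only [nbChoices, nextSet, Finset.mem_filter, Finset.mem_erase]
    rw [and_comm]
    refine and_congr_left fun _ => ⟨fun h => h _ (by simp), fun h i hi => ?_⟩
    have : i = (Fin.last k).castSucc := by
      apply Fin.ext; simp; omega
    rwa [this]

theorem sum_nbStep_mul {k : ℕ} (w : Fin (k + 1) → V) (h : (nbChoices G w).Nonempty) (f : V → ℝ) :
    ∑ v, (nbStep G w v).toReal * f v = (∑ v ∈ nbChoices G w, f v) / (nbChoices G w).card := by
  rw [nbStep, dif_pos h, Finset.sum_div, ← Finset.sum_subset (Finset.subset_univ (nbChoices G w))]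
  · refine Finset.sum_congr rfl fun v hv => ?_
    rw [PMF.uniformOfFinset_apply_of_mem _ hv, ENNReal.toReal_inv, ENNReal.toReal_natCast]
    ring
  · intro v _ hv
    rw [PMF.uniformOfFinset_apply_of_notMem _ hv]; simp

theorem sum_bind_toReal_mul {α β : Type*} [Fintype α] [Fintype β] (p : PMF α) (q : α → PMF β)
    (f : β → ℝ) :
    ∑ b, (p.bind q b).toReal * f b = ∑ a, (p a).toReal * ∑ b, (q a b).toReal * f b := by
  simp only [Finset.mul_sum]
  rw [Finset.sum_comm]
  refine Finset.sum_congr rfl fun b _ => ?_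
  rw [PMF.bind_apply, tsum_fintype, ENNReal.toReal_sum, Finset.sum_mul]
  · exact Finset.sum_congr rfl fun a _ => by rw [ENNReal.toReal_mul, mul_assoc]
  · intro a _
    exact ENNReal.mul_ne_top (p.apply_ne_top a) ((q a).apply_ne_top b)

theorem sum_pure_toReal_mul {α : Type*} [Fintype α] (a : α) (f : α → ℝ) :
    ∑ b, (PMF.pure a b).toReal * f b = f a := by
  classical
  rw [Finset.sum_eq_single a]
  · simp
  · intro b _ hb
    rw [PMF.pure_apply_of_ne _ _ hb]; simp
  · simp

theorem sum_map_toReal_mul {α β : Type*} [Fintype α] [Fintype β] (p : PMF α) (g : α → β)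
    (f : β → ℝ) : ∑ b, (p.map g b).toReal * f b = ∑ a, (p a).toReal * f (g a) := by
  rw [PMF.map, sum_bind_toReal_mul]
  exact Finset.sum_congr rfl fun a _ => by rw [Function.comp, sum_pure_toReal_mul]

variable {G}

/-- The expectation of a function of the walk is the iterated one-step expectation. -/
theorem sum_nbWalk_mul {d : ℕ} (hreg : G.IsRegularOfDegree d) (hd : 3 ≤ d) (w₀ : V) (k : ℕ)
    (f : List V → ℝ) :
    ∑ w, (nbWalk G w₀ k w).toReal * f (toHist w) = histExp G k f [w₀] := by
  induction k generalizing f with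
  | zero =>
    rw [nbWalk, sum_pure_toReal_mul]
    simp [toHist, histExp_zero]
  | succ k ih =>
    rw [histExp_succ, ← ih, nbWalk, sum_bind_toReal_mul]
    refine Finset.sum_congr rfl fun w _ => ?_
    congr 1
    have hne : toHist w ≠ [] := by
      rw [← List.length_pos_iff]; simp [toHist]
    have hpos := card_nextSet_pos hreg hd hne
    rw [sum_map_toReal_mul, sum_nbStep_mul G w
      (by rw [nbChoices_eq_nextSet]; exact Finset.card_pos.1 hpos), stepAvg, nbChoices_eq_nextSet]
    simp only [toHist_snoc]

theorem pmfProb_eq_sum {α : Type*} [Fintype α] (p : PMF α) (s : Set α) [DecidablePred (· ∈ s)] :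
    pmfProb p s = ∑ a, (p a).toReal * if a ∈ s then 1 else 0 := by
  rw [pmfProb, PMF.toOuterMeasure_apply, tsum_fintype, ENNReal.toReal_sum]
  · refine Finset.sum_congr rfl fun a _ => ?_
    by_cases h : a ∈ s <;> simp [h]
  · intro a _
    by_cases h : a ∈ s <;> simp [h, p.apply_ne_top a]

/-- The start is the last entry of the history, so `dropLast` implements the condition `1 ≤ i`. -/
theorem numVisits_eq_count {k : ℕ} (w : Fin (k + 1) → V) (v : V) :
    numVisits w v = (toHist w).dropLast.count v := by
  induction k with
  | zero =>
    have : toHist w = [w 0] := by simp [toHist]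
    rw [this, numVisits, Finset.card_eq_zero.2]
    · simp
    · ext i; simp
  | succ k ih =>
    have h1 : toHist w = w (Fin.last (k + 1)) :: toHist (fun i : Fin (k + 1) => w i.castSucc) := by
      rw [← toHist_snoc]
      congr 1
      exact (Fin.snoc_init_self w).symm
    have hne : toHist (fun i : Fin (k + 1) => w i.castSucc) ≠ [] := by
      rw [← List.length_pos_iff]; simp [toHist]
    rw [h1, List.dropLast_cons_of_ne_nil hne, List.count_cons, ← ih]
    unfold numVisits
    rw [Finset.card_filter, Finset.card_filter, Fin.sum_univ_castSucc]
    congr 1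
    simp

end Law

/-! ### Visit counts and the cost of freezing them. -/

section Discrepancy

variable {V : Type u} [Fintype V] [DecidableEq V]

/-- The indicator that `v` was visited exactly `t` times, not counting the starting point. -/
def visitInd (t : ℕ) (l : List V) (v : V) : ℝ := if l.dropLast.count v = t then 1 else 0

/-- The fraction of vertices visited exactly `t` times. -/
def visitFrac (t : ℕ) (l : List V) : ℝ := (∑ v, visitInd t l v) / Fintype.card V

/-- The indicator that the latest vertex had been visited exactly `t` times before, centred by the
fraction of such vertices. -/
def discrepancy (t : ℕ) : List V → ℝ
  | [] => 0
  | v :: l => visitInd t l v - visitFrac t l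

/-- The indicator of a return to the position `m` steps ago. -/
def returnInd (m : ℕ) (l : List V) : ℝ := if l[0]? = l[m]? then 1 else 0

theorem visitInd_nonneg (t : ℕ) (l : List V) (v : V) : 0 ≤ visitInd t l v := by
  unfold visitInd; split_ifs <;> norm_num

theorem visitInd_le_one (t : ℕ) (l : List V) (v : V) : visitInd t l v ≤ 1 := by
  unfold visitInd; split_ifs <;> norm_num

theorem visitFrac_nonneg (t : ℕ) (l : List V) : 0 ≤ visitFrac t l :=
  div_nonneg (Finset.sum_nonneg fun v _ => visitInd_nonneg t l v) (Nat.cast_nonneg _)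

theorem visitFrac_le_one (t : ℕ) (l : List V) : visitFrac t l ≤ 1 := by
  refine div_le_one_of_le₀ ?_ (Nat.cast_nonneg _)
  refine (Finset.sum_le_sum fun v _ => visitInd_le_one t l v).trans ?_
  simp

theorem abs_discrepancy_le_one (t : ℕ) (l : List V) : |discrepancy t l| ≤ 1 := by
  cases l with
  | nil => simp [discrepancy]
  | cons v l =>
    rw [discrepancy, abs_le]
    constructor <;>
    linarith [visitInd_nonneg t l v, visitInd_le_one t l v, visitFrac_nonneg t l,
      visitFrac_le_one t l]

theorem abs_visitInd_sub_le (t : ℕ) {K : ℕ} {l L : List V} (hl : l ≠ []) (hL : L.drop K = l)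
    (v : V) : |visitInd t L v - visitInd t l v| ≤ ((L.take K).count v : ℝ) := by
  have h1 : L.dropLast.count v = (L.take K).count v + l.dropLast.count v := by
    conv_lhs => rw [← List.take_append_drop K L, hL]
    rw [List.dropLast_append_of_ne_nil hl, List.count_append]
  rcases Nat.eq_zero_or_pos ((L.take K).count v) with h0 | hpos
  · simp [visitInd, h1, h0]
  · have h2 : (1 : ℝ) ≤ ((L.take K).count v : ℝ) := by exact_mod_cast hpos
    refine le_trans ?_ h2
    rw [abs_le]
    constructor <;>
    linarith [visitInd_nonneg t l v, visitInd_le_one t l v, visitInd_nonneg t L v,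
      visitInd_le_one t L v]

theorem abs_visitFrac_sub_le (t : ℕ) {K : ℕ} {l L : List V} (hl : l ≠ []) (hL : L.drop K = l) :
    |visitFrac t L - visitFrac t l| ≤ K / Fintype.card V := by
  unfold visitFrac
  rw [← sub_div, abs_div, Nat.abs_cast, ← Finset.sum_sub_distrib]
  refine div_le_div_of_nonneg_right ?_ (Nat.cast_nonneg _)
  refine (Finset.abs_sum_le_sum_abs _ _).trans ?_
  refine (Finset.sum_le_sum fun v _ => abs_visitInd_sub_le t hl hL v).trans ?_
  have h := Multiset.sum_count_eq_card (s := Finset.univ) (m := (↑(L.take K) : Multiset V))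
    (fun a _ => Finset.mem_univ a)
  simp only [Multiset.coe_count, Multiset.coe_card] at h
  have h2 : (L.take K).length ≤ K := by simp
  exact_mod_cast h.trans_le h2

theorem count_take_le_sum (K : ℕ) (L : List V) (v : V) :
    ((L.take K).count v : ℝ) ≤ ∑ m ∈ Finset.range K, if some v = L[m]? then 1 else 0 := by
  induction K generalizing L with
  | zero => simp
  | succ K ih =>
    cases L with
    | nil => simp
    | cons a L =>
      rw [Finset.sum_range_succ', List.take_succ_cons, List.count_cons]
      have h := ih L
      simp only [List.getElem?_cons_succ, List.getElem?_cons_zero, Option.some.injEq]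
      push_cast
      refine add_le_add h (le_of_eq ?_)
      by_cases hv : a = v
      · simp [hv]
      · simp [hv, Ne.symm hv]

/-- Replacing the counts by those of `l` changes the indicator at the new vertex only if that vertex
occurs among the `K` intermediate ones, and moves the fraction by at most `K / n`. -/
theorem abs_discrepancy_sub_le (t : ℕ) {K : ℕ} {l L : List V} (hl : l ≠ [])
    (hL : L.drop (K + 1) = l) :
    |discrepancy t L - headFun (fun v => visitInd t l v - visitFrac t l) L| ≤
      (∑ m ∈ Finset.range K, returnInd (m + 1) L) + K / Fintype.card V := by
  cases L with
  | nil => simp at hL; exact absurd hL hl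
  | cons v L =>
    rw [List.drop_succ_cons] at hL
    have h1 := (abs_visitInd_sub_le t hl hL v).trans (count_take_le_sum K L v)
    have h2 := abs_visitFrac_sub_le t hl hL
    simp only [discrepancy, headFun]
    have h3 : ∑ m ∈ Finset.range K, returnInd (m + 1) (v :: L) =
        ∑ m ∈ Finset.range K, if some v = L[m]? then (1 : ℝ) else 0 := by
      simp [returnInd]
    rw [h3]
    rw [abs_le] at *
    constructor <;> linarith [h1.1, h1.2, h2.1, h2.2]

end Discrepancy

/-! ### Return probabilities and decorrelation. -/

section Mixing

variable {V : Type u} [Fintype V] [DecidableEq V] {G : SimpleGraph V} [DecidableRel G.Adj]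

/-- The mixing property of the non-backtracking walk on `G`: mean-zero edge functions decay
exponentially. -/
def EdgeMixing (G : SimpleGraph V) [DecidableRel G.Adj] (d : ℕ) (C ρ : ℝ) : Prop :=
  ∀ F : V → V → ℝ, edgeSum G F = 0 → ∀ (k : ℕ) (a b : V), G.Adj a b →
    |(edgeOp G ((d : ℝ) - 1))^[k] F a b| ≤ C * ρ ^ k * √(edgeSq G F)

theorem abs_histExp_headFun_le {d : ℕ} (hreg : G.IsRegularOfDegree d) (hd : 3 ≤ d) {C ρ : ℝ}
    (hmix : EdgeMixing G d C ρ) (f : V → ℝ) (hf : ∑ v, f v = 0) (k : ℕ) {l : List V}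
    (hl : IsHist G l) (hlen : 2 ≤ l.length) :
    |histExp G k (headFun f) l| ≤ C * ρ ^ k * √(d * ∑ v, f v ^ 2) := by
  match l, hlen with
  | b :: a :: r, _ =>
    rw [histExp_headFun hreg hd f k hl]
    have h1 : edgeSum G (fun _ v => f v) = 0 := by
      rw [edgeSum_swap G (fun a _ => f a), edgeSum_fst hreg, hf, mul_zero]
    have h2 : edgeSq G (fun _ v => f v) = d * ∑ v, f v ^ 2 := by
      unfold edgeSq
      rw [edgeSum_swap G (fun a _ => f a ^ 2), edgeSum_fst hreg]
    rw [← h2]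
    exact hmix _ h1 k a b hl.adj

theorem sum_sub_mean [Nonempty V] (f : V → ℝ) : ∑ v, (f v - (∑ u, f u) / Fintype.card V) = 0 := by
  have : (Fintype.card V : ℝ) ≠ 0 := by exact_mod_cast Fintype.card_ne_zero
  rw [Finset.sum_sub_distrib, Finset.sum_const, Finset.card_univ, nsmul_eq_mul]
  field_simp
  ring

theorem sum_sub_mean_sq_le [Nonempty V] (f : V → ℝ) :
    ∑ v, (f v - (∑ u, f u) / Fintype.card V) ^ 2 ≤ ∑ v, f v ^ 2 := by
  have hn : (0 : ℝ) < Fintype.card V := by exact_mod_cast Fintype.card_pos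
  set c := (∑ u, f u) / Fintype.card V with hc
  have h1 : ∑ v, (f v - c) ^ 2 = ∑ v, f v ^ 2 - 2 * c * ∑ v, f v + Fintype.card V * c ^ 2 := by
    simp only [sub_sq, Finset.sum_add_distrib, Finset.sum_sub_distrib, Finset.sum_const,
      Finset.card_univ, nsmul_eq_mul, Finset.mul_sum]
    congr 2
    exact Finset.sum_congr rfl fun v _ => by ring
  have h2 : ∑ v, f v = Fintype.card V * c := by rw [hc]; field_simp
  rw [h1, h2]
  nlinarith [sq_nonneg c]

/-- The probability of returning after `m` steps is at most `1 / n` up to an exponentially small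
error, and vanishes below the girth. -/
theorem histExp_returnInd_le {d : ℕ} (hreg : G.IsRegularOfDegree d) (hd : 3 ≤ d) {C ρ : ℝ}
    (hC : 0 ≤ C) (hρ : 0 ≤ ρ) (hmix : EdgeMixing G d C ρ) {g : ℕ} (hg : (g : ℕ∞) ≤ G.egirth) {m : ℕ} (hm : 1 ≤ m)
    {l : List V} (hl : IsHist G l) (hlen : 2 ≤ l.length) :
    histExp G m (returnInd m) l ≤
      if m < g then 0 else 1 / (Fintype.card V : ℝ) + C * ρ ^ m * √d := by
  split_ifs with hmg
  · refine histExp_le_of_le hreg hd hl fun L hL hLlen _ => ?_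
    rw [returnInd, if_neg]
    intro he
    have h1 := hL.egirth_le hm (by omega) he
    have h2 : (g : ℕ∞) ≤ m := hg.trans h1
    have : g ≤ m := by exact_mod_cast h2
    omega
  · match l, hlen with
    | b :: a :: r, hlen =>
      have : Nonempty V := ⟨b⟩
      -- A return is the point mass at the current vertex evaluated `m` steps later; once centred,
      -- its squared norm is at most `1`.
      set e : V → ℝ := fun v => if v = b then 1 else 0 with he
      have hsum : ∑ v, e v = 1 := by simp [he]
      have hsq : ∑ v, e v ^ 2 = 1 := by simp [he]
      have h0 := sum_sub_mean e
      have h2 := sum_sub_mean_sq_le e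
      rw [hsum] at h0 h2
      rw [hsq] at h2
      have hmain := abs_histExp_headFun_le hreg hd hmix _ h0 m hl hlen
      have hmono : C * ρ ^ m * √(d * ∑ v, (e v - 1 / (Fintype.card V : ℝ)) ^ 2) ≤
          C * ρ ^ m * √d := by
        refine mul_le_mul_of_nonneg_left (Real.sqrt_le_sqrt ?_) (by positivity)
        exact mul_le_of_le_one_right (Nat.cast_nonneg _) h2
      have hcongr : histExp G m (returnInd m) (b :: a :: r) =
          histExp G m (fun L => headFun (fun v => e v - 1 / (Fintype.card V : ℝ)) L +
            1 / (Fintype.card V : ℝ)) (b :: a :: r) := by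
        refine histExp_congr hl fun L hL hLlen hdrop => ?_
        have h5 : L[m]? = some b := by
          have : (L.drop m)[0]? = some b := by rw [hdrop]; rfl
          rwa [List.getElem?_drop, add_zero] at this
        cases L with
        | nil => simp at h5
        | cons v L =>
          simp [returnInd, h5, headFun, he]
      rw [hcongr, histExp_add, histExp_const hreg hd m _ hl.ne_nil]
      linarith [(abs_le.1 hmain).2]

/-- Beyond `K` steps, the discrepancy is nearly uncorrelated with the history. -/
theorem abs_histExp_discrepancy_le {d : ℕ} (hreg : G.IsRegularOfDegree d) (hd : 3 ≤ d) {C ρ : ℝ}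
    (hC : 0 ≤ C) (hρ : 0 ≤ ρ) (hmix : EdgeMixing G d C ρ) {g : ℕ} (hg : (g : ℕ∞) ≤ G.egirth)
    (t K : ℕ) {l : List V} (hl : IsHist G l) (hlen : 2 ≤ l.length) :
    |histExp G (K + 1) (discrepancy t) l| ≤
      C * ρ ^ (K + 1) * √(d * Fintype.card V) +
        ((∑ m ∈ Finset.range K,
          if m + 1 < g then 0 else 1 / (Fintype.card V : ℝ) + C * ρ ^ (m + 1) * √d) +
        K / Fintype.card V) := by
  have : Nonempty V := ⟨l.head hl.ne_nil⟩
  set f : V → ℝ := fun v => visitInd t l v - visitFrac t l with hf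
  set B : List V → ℝ := fun L => ∑ m ∈ Finset.range K, returnInd (m + 1) L with hB
  have h1 : |histExp G (K + 1) (headFun f) l| ≤ C * ρ ^ (K + 1) * √(d * Fintype.card V) := by
    refine (abs_histExp_headFun_le hreg hd hmix f (sum_sub_mean _) _ hl hlen).trans ?_
    refine mul_le_mul_of_nonneg_left (Real.sqrt_le_sqrt ?_) (by positivity)
    refine mul_le_mul_of_nonneg_left ((sum_sub_mean_sq_le _).trans ?_) (Nat.cast_nonneg _)
    calc ∑ v, visitInd t l v ^ 2 ≤ ∑ _v : V, (1 : ℝ) := Finset.sum_le_sum fun v _ =>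
          pow_le_one₀ (visitInd_nonneg t l v) (visitInd_le_one t l v)
      _ = Fintype.card V := by simp
  have h2 : histExp G (K + 1) B l ≤ ∑ m ∈ Finset.range K,
      if m + 1 < g then 0 else 1 / (Fintype.card V : ℝ) + C * ρ ^ (m + 1) * √d := by
    rw [hB, histExp_sum]
    refine Finset.sum_le_sum fun m hm => ?_
    have hm' := Finset.mem_range.1 hm
    -- Condition on the moment `m + 1` steps before the end, whose vertex is the target of the
    -- return.
    rw [show K + 1 = (K - m) + (m + 1) by omega, histExp_add_steps]
    exact histExp_le_of_le hreg hd hl fun L hL hLlen _ =>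
      histExp_returnInd_le hreg hd hC hρ hmix hg (by omega) hL (by omega)
  have h3 : ∀ s : ℝ, |s| = 1 → s * histExp G (K + 1) (discrepancy t) l ≤
      s * histExp G (K + 1) (headFun f) l + (histExp G (K + 1) B l + K / Fintype.card V) := by
    intro s hs
    rw [← histExp_const hreg hd (K + 1) ((K : ℝ) / Fintype.card V) hl.ne_nil,
      ← histExp_const_mul, ← histExp_const_mul, ← histExp_add, ← histExp_add]
    refine histExp_mono hl fun L _ _ hdrop => ?_
    have h4 := abs_discrepancy_sub_le t hl.ne_nil hdrop
    have h5 : s * (discrepancy t L - headFun f L) ≤ |discrepancy t L - headFun f L| := by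
      refine (le_abs_self _).trans ?_
      rw [abs_mul, hs, one_mul]
    linarith
  rw [abs_le] at h1 ⊢
  have h6 := h3 1 (by simp)
  have h7 := h3 (-1) (by simp)
  constructor <;> linarith [h1.1, h1.2]

end Mixing

/-! ### Second moment of the accumulated discrepancy. -/

section Variance

variable {V : Type u} [Fintype V] [DecidableEq V] {G : SimpleGraph V} [DecidableRel G.Adj]

theorem histExp_drop_mul (k : ℕ) (f g : List V → ℝ) {l : List V} (hl : IsHist G l) :
    histExp G k (fun L => f (L.drop k) * g L) l = f l * histExp G k g l := by
  rw [← histExp_const_mul]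
  exact histExp_congr hl fun L _ _ h => by rw [h]

theorem histExp_drop {d : ℕ} (hreg : G.IsRegularOfDegree d) (hd : 3 ≤ d) (j k : ℕ)
    (f : List V → ℝ) {l : List V} (hl : IsHist G l) :
    histExp G (j + k) (fun L => f (L.drop k)) l = histExp G j f l := by
  rw [histExp_add_steps]
  refine histExp_congr hl fun L hL _ _ => ?_
  rw [histExp_congr (g := fun _ => f L) hL fun L' _ _ h => by rw [h],
    histExp_const hreg hd k _ hL.ne_nil]

/-- The sum of the discrepancies along a history. -/
def discSum (t : ℕ) : List V → ℝ
  | [] => 0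
  | [_] => 0
  | v :: u :: l => discSum t (u :: l) + discrepancy t (v :: u :: l)

theorem discSum_cons (t : ℕ) (v : V) {l : List V} (hl : l ≠ []) :
    discSum t (v :: l) = discSum t l + discrepancy t (v :: l) := by
  cases l with
  | nil => exact absurd rfl hl
  | cons u l => rfl

theorem abs_discSum_sub_drop_le (t k : ℕ) (l : List V) :
    |discSum t l - discSum t (l.drop k)| ≤ k := by
  induction k generalizing l with
  | zero => simp
  | succ k ih =>
    cases l with
    | nil => simp; positivity
    | cons v l =>
      rw [List.drop_succ_cons]
      have h1 : |discSum t (v :: l) - discSum t l| ≤ 1 := by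
        by_cases hl : l = []
        · subst hl; simp [discSum]
        · rw [discSum_cons t v hl, add_sub_cancel_left]
          exact abs_discrepancy_le_one t _
      have h2 := ih l
      push_cast
      rw [abs_le] at *
      constructor <;> linarith [h1.1, h1.2, h2.1, h2.2]

variable {d : ℕ} (hreg : G.IsRegularOfDegree d) (hd : 3 ≤ d) {K : ℕ} {ε : ℝ} (hε : 0 ≤ ε)
  {t : ℕ} (hlag : ∀ l, IsHist G l → 2 ≤ l.length → |histExp G (K + 1) (discrepancy t) l| ≤ ε)
  (w₀ : V)

include hreg hd hε hlag

/-- The accumulated discrepancy is nearly uncorrelated with the next one. -/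
theorem abs_histExp_discSum_mul_discrepancy_le (j : ℕ) :
    |histExp G (j + 1) (fun L => discSum t (L.drop 1) * discrepancy t L) [w₀]| ≤ K + j * ε := by
  have hw : IsHist G [w₀] := IsHist.single w₀
  have hS : ∀ (j : ℕ) (L : List V), L.drop j = [w₀] → |discSum t L| ≤ j := by
    intro j L hL
    have h := abs_discSum_sub_drop_le t j L
    rwa [hL, discSum, sub_zero] at h
  rcases le_or_gt j K with hjK | hjK
  · refine (abs_histExp_le_of_le hreg hd hw (c := j) fun L _ _ hdrop => ?_).trans ?_
    · rw [abs_mul]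
      refine (mul_le_of_le_one_right (abs_nonneg _) (abs_discrepancy_le_one t L)).trans
        (hS j _ ?_)
      rw [List.drop_drop, add_comm 1 j]
      exact hdrop
    · have : (j : ℝ) ≤ K := by exact_mod_cast hjK
      nlinarith [mul_nonneg (Nat.cast_nonneg (α := ℝ) j) hε]
  -- Rewinding the partial sum by `K` steps costs at most `K`; the rewound sum is known when the lag
  -- estimate applies. Here `i ≥ 1`, so that history contains an edge.
  · obtain ⟨i, rfl⟩ : ∃ i, j = i + K := ⟨j - K, by omega⟩
    have h1 : histExp G (i + K + 1) (fun L => discSum t (L.drop 1) * discrepancy t L) [w₀] =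
        histExp G (i + K + 1) (fun L => (discSum t (L.drop 1) - discSum t ((L.drop 1).drop K)) *
          discrepancy t L) [w₀] +
        histExp G (i + K + 1) (fun L => discSum t (L.drop (K + 1)) * discrepancy t L) [w₀] := by
      rw [← histExp_add]
      congr 1
      funext L
      rw [List.drop_drop, add_comm 1 K]
      ring
    have h2 : |histExp G (i + K + 1) (fun L => (discSum t (L.drop 1) -
        discSum t ((L.drop 1).drop K)) * discrepancy t L) [w₀]| ≤ K := by
      refine abs_histExp_le_of_le hreg hd hw fun L _ _ _ => ?_
      rw [abs_mul]
      exact (mul_le_of_le_one_right (abs_nonneg _) (abs_discrepancy_le_one t L)).trans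
        (abs_discSum_sub_drop_le t K _)
    have h3 : |histExp G (i + K + 1) (fun L => discSum t (L.drop (K + 1)) * discrepancy t L)
        [w₀]| ≤ i * ε := by
      rw [add_assoc, histExp_add_steps]
      refine abs_histExp_le_of_le hreg hd hw fun L hL hlen hdrop => ?_
      rw [histExp_drop_mul _ _ _ hL, abs_mul]
      refine mul_le_mul (hS i L hdrop) (hlag L hL ?_) (abs_nonneg _) (Nat.cast_nonneg _)
      rw [hlen, List.length_singleton]; omega
    rw [h1]
    refine (abs_add_le _ _).trans ?_
    have h4 : (i : ℝ) * ε ≤ ((i + K : ℕ) : ℝ) * ε := by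
      push_cast; nlinarith [mul_nonneg (Nat.cast_nonneg (α := ℝ) K) hε]
    linarith

/-- Expanding the square of the sum, each step adds at most `1` from the diagonal and twice the
correlation with the past. -/
theorem histExp_discSum_sq_le (n j : ℕ) (hj : j ≤ n) :
    histExp G j (fun L => discSum t L ^ 2) [w₀] ≤ j * (1 + 2 * (K + n * ε)) := by
  have hw : IsHist G [w₀] := IsHist.single w₀
  induction j with
  | zero => simp [histExp_zero, discSum]
  | succ j ih =>
    have h1 : histExp G (j + 1) (fun L => discSum t L ^ 2) [w₀] =
        histExp G (j + 1) (fun L => discSum t (L.drop 1) ^ 2) [w₀] +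
        (2 * histExp G (j + 1) (fun L => discSum t (L.drop 1) * discrepancy t L) [w₀] +
        histExp G (j + 1) (fun L => discrepancy t L ^ 2) [w₀]) := by
      rw [← histExp_const_mul, ← histExp_add, ← histExp_add]
      refine histExp_congr hw fun L _ hlen _ => ?_
      cases L with
      | nil => simp at hlen
      | cons v L =>
        have : L ≠ [] := by
          rw [← List.length_pos_iff]; simp at hlen; omega
        rw [discSum_cons t v this, List.drop_one, List.tail_cons]
        ring
    have h2 : histExp G (j + 1) (fun L => discSum t (L.drop 1) ^ 2) [w₀] ≤
        j * (1 + 2 * (K + n * ε)) := by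
      rw [histExp_drop hreg hd j 1 (fun L => discSum t L ^ 2) hw]
      exact ih (by omega)
    have h3 := (abs_le.1 (abs_histExp_discSum_mul_discrepancy_le hreg hd hε hlag w₀ j)).2
    have h4 : histExp G (j + 1) (fun L => discrepancy t L ^ 2) [w₀] ≤ 1 := by
      refine histExp_le_of_le hreg hd hw fun L _ _ _ => ?_
      rw [← sq_abs]
      exact pow_le_one₀ (abs_nonneg _) (abs_discrepancy_le_one t L)
    have h5 : (j : ℝ) * ε ≤ n * ε := by
      refine mul_le_mul_of_nonneg_right ?_ hε
      exact_mod_cast (by omega : j ≤ n)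
    rw [h1]
    push_cast
    linarith

theorem histExp_abs_discSum_le {n : ℕ} (hn : 0 < n) {κ : ℝ} (hκ : 0 < κ)
    (hκε : 1 + 2 * (K + n * ε) ≤ n * κ ^ 2) (j : ℕ) (hj : j ≤ n) :
    histExp G j (fun L => |discSum t L|) [w₀] ≤ n * κ := by
  have hw : IsHist G [w₀] := IsHist.single w₀
  have hn' : (0 : ℝ) < n := by exact_mod_cast hn
  have hj' : (j : ℝ) ≤ n := by exact_mod_cast hj
  have h1 := histExp_discSum_sq_le hreg hd hε hlag w₀ n j hj
  have h2 : histExp G j (fun L => discSum t L ^ 2) [w₀] ≤ (n * κ) ^ 2 := by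
    refine h1.trans ?_
    calc (j : ℝ) * (1 + 2 * (K + n * ε)) ≤ n * (n * κ ^ 2) := by gcongr
      _ = (n * κ) ^ 2 := by ring
  have h3 : histExp G j (fun L => |discSum t L|) [w₀] ≤
      -- A weighted arithmetic-geometric mean inequality stands in for Cauchy–Schwarz.
      histExp G j (fun L => 1 / (2 * (n * κ)) * discSum t L ^ 2 + n * κ / 2) [w₀] := by
    refine histExp_mono hw fun L _ _ _ => ?_
    have h4 : 1 / (2 * (n * κ)) * discSum t L ^ 2 + n * κ / 2 - |discSum t L| =
        (|discSum t L| - n * κ) ^ 2 / (2 * (n * κ)) := by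
      rw [← sq_abs (discSum t L)]
      field_simp
      ring
    have h5 : 0 ≤ (|discSum t L| - n * κ) ^ 2 / (2 * (n * κ)) := by positivity
    linarith
  rw [histExp_add, histExp_const_mul, histExp_const hreg hd _ _ hw.ne_nil] at h3
  refine h3.trans ?_
  have h6 : 1 / (2 * (n * κ)) * histExp G j (fun L => discSum t L ^ 2) [w₀] ≤
      1 / (2 * (n * κ)) * (n * κ) ^ 2 := mul_le_mul_of_nonneg_left h2 (by positivity)
  have h7 : 1 / (2 * (n * κ)) * (n * κ) ^ 2 = n * κ / 2 := by field_simp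
  linarith

end Variance

/-! ### Comparison with the binomial recursion. -/

section Evolution

variable {V : Type u} [Fintype V] [DecidableEq V] {G : SimpleGraph V} [DecidableRel G.Adj]

/-- The binomial probabilities for `i` trials of success probability `1 / n`. -/
def binomProb (n t i : ℕ) : ℝ := i.choose t * (1 / (n : ℝ)) ^ t * (1 - 1 / (n : ℝ)) ^ (i - t)

theorem binomProb_zero_succ (n i : ℕ) :
    binomProb n 0 (i + 1) = binomProb n 0 i - 1 / n * binomProb n 0 i := by
  simp [binomProb, pow_succ]; ring

theorem binomProb_succ_succ (n t i : ℕ) :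
    binomProb n (t + 1) (i + 1) =
      binomProb n (t + 1) i + 1 / n * (binomProb n t i - binomProb n (t + 1) i) := by
  unfold binomProb
  rcases lt_trichotomy i t with h | h | h
  · rw [Nat.choose_eq_zero_of_lt h, Nat.choose_eq_zero_of_lt (by omega),
      Nat.choose_eq_zero_of_lt (by omega)]
    simp
  · subst h
    simp [pow_succ, mul_comm]
  · obtain ⟨e, rfl⟩ : ∃ e, i = t + 1 + e := ⟨i - (t + 1), by omega⟩
    rw [show t + 1 + e + 1 - (t + 1) = e + 1 by omega, show t + 1 + e - (t + 1) = e by omega,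
      show t + 1 + e - t = e + 1 by omega, Nat.choose_succ_succ]
    push_cast
    ring

theorem sum_visitInd_zero_cons (v : V) {l : List V} (hl : l ≠ []) :
    ∑ u, visitInd 0 (v :: l) u = (∑ u, visitInd 0 l u) - visitInd 0 l v := by
  have h : ∀ u, visitInd 0 (v :: l) u =
      visitInd 0 l u - if u = v then visitInd 0 l v else 0 := by
    intro u
    unfold visitInd
    rw [List.dropLast_cons_of_ne_nil hl, List.count_cons]
    by_cases huv : u = v
    · subst huv; simp
    · simp [huv, Ne.symm huv]
  simp only [h, Finset.sum_sub_distrib, Finset.sum_ite_eq', Finset.mem_univ, if_true]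

theorem sum_visitInd_succ_cons (t : ℕ) (v : V) {l : List V} (hl : l ≠ []) :
    ∑ u, visitInd (t + 1) (v :: l) u =
      (∑ u, visitInd (t + 1) l u) + (visitInd t l v - visitInd (t + 1) l v) := by
  have h : ∀ u, visitInd (t + 1) (v :: l) u = visitInd (t + 1) l u +
      if u = v then visitInd t l v - visitInd (t + 1) l v else 0 := by
    intro u
    unfold visitInd
    rw [List.dropLast_cons_of_ne_nil hl, List.count_cons]
    by_cases huv : u = v
    · subst huv; simp
    · simp [huv, Ne.symm huv]
  simp only [h, Finset.sum_add_distrib, Finset.sum_ite_eq', Finset.mem_univ, if_true]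

/-- The deviation of the fraction of vertices visited `t` times from the binomial probability. -/
def visitDev (t : ℕ) (l : List V) : ℝ :=
  visitFrac t l - binomProb (Fintype.card V) t (l.length - 1)

theorem visitDev_zero_cons (v : V) {l : List V} (hl : l ≠ []) :
    visitDev 0 (v :: l) = visitDev 0 l -
      (visitDev 0 l + discrepancy 0 (v :: l)) / Fintype.card V := by
  have hlen : (v :: l).length - 1 = (l.length - 1) + 1 := by
    have := List.length_pos_iff.2 hl
    rw [List.length_cons]; omega
  unfold visitDev
  rw [hlen, binomProb_zero_succ, discrepancy]
  unfold visitFrac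
  rw [sum_visitInd_zero_cons v hl]
  ring

/-- Pascal's rule gives the binomial probabilities the same recursion without noise, so only
discrepancies drive the deviation. -/
theorem visitDev_succ_cons (t : ℕ) (v : V) {l : List V} (hl : l ≠ []) :
    visitDev (t + 1) (v :: l) = visitDev (t + 1) l +
      (visitDev t l + discrepancy t (v :: l) -
        (visitDev (t + 1) l + discrepancy (t + 1) (v :: l))) / Fintype.card V := by
  have hlen : (v :: l).length - 1 = (l.length - 1) + 1 := by
    have := List.length_pos_iff.2 hl
    rw [List.length_cons]; omega
  unfold visitDev
  rw [hlen, binomProb_succ_succ, discrepancy, discrepancy]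
  unfold visitFrac
  rw [sum_visitInd_succ_cons t v hl]
  ring

theorem visitDev_singleton (t : ℕ) (w : V) : visitDev t [w] = 0 := by
  have : (Fintype.card V : ℝ) ≠ 0 := by
    have : Nonempty V := ⟨w⟩
    exact_mod_cast Fintype.card_ne_zero
  cases t with
  | zero => simp [visitDev, visitFrac, visitInd, binomProb, this]
  | succ t => simp [visitDev, visitFrac, visitInd, binomProb]

/-- A Gronwall estimate in expectation, for a process `X` driven by a process `Y` and a noise
term `N`. -/
theorem histExp_abs_le_of_recursion {d : ℕ} (hreg : G.IsRegularOfDegree d) (hd : 3 ≤ d) (w₀ : V)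
    {n : ℕ} (hn : 0 < n) (X Y N : List V → ℝ) {α β : ℝ} (hα : 0 ≤ α) (hβ : 0 ≤ β)
    (hX0 : X [w₀] = 0) (hN0 : N [w₀] = 0)
    (hrec : ∀ (v : V) (l : List V), l ≠ [] →
      X (v :: l) - N (v :: l) = X l - N l + (Y l - X l) / n)
    (hY : ∀ i ≤ n, histExp G i (fun L => |Y L|) [w₀] ≤ α)
    (hN : ∀ i ≤ n, histExp G i (fun L => |N L|) [w₀] ≤ β) (i : ℕ) (hi : i ≤ n) :
    histExp G i (fun L => |X L|) [w₀] ≤ 2 * α + 3 * β := by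
  have hw : IsHist G [w₀] := IsHist.single w₀
  have hn' : (0 : ℝ) < n := by exact_mod_cast hn
  have hXR : ∀ i ≤ n, histExp G i (fun L => |X L|) [w₀] ≤
      histExp G i (fun L => |X L - N L|) [w₀] + β := by
    intro i hi
    refine le_trans ?_ (add_le_add_right (hN i hi) _)
    rw [← histExp_add]
    refine histExp_mono hw fun L _ _ _ => ?_
    have := abs_add_le (X L - N L) (N L)
    rwa [sub_add_cancel] at this
  -- Subtracting the accumulated noise leaves increments of size `1 / n`, so cancellation inside `N`
  -- survives taking absolute values. The growth factor is below `e - 1 < 2`, and adding `N` back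
  -- gives `2α + 3β`.
  have hR : ∀ i ≤ n, histExp G i (fun L => |X L - N L|) [w₀] ≤
      ((1 + 1 / (n : ℝ)) ^ i - 1) * (α + β) := by
    intro i
    induction i with
    | zero => intro _; simp [histExp_zero, hX0, hN0]
    | succ i ih =>
      intro hi
      have h1 := ih (by omega)
      have h2 : histExp G (i + 1) (fun L => |X L - N L|) [w₀] ≤
          histExp G (i + 1) (fun L => |X (L.drop 1) - N (L.drop 1)| +
            1 / (n : ℝ) * (|Y (L.drop 1)| + |X (L.drop 1)|)) [w₀] := by
        refine histExp_mono hw fun L _ hlen _ => ?_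
        cases L with
        | nil => simp at hlen
        | cons v L =>
          have hL : L ≠ [] := by
            rw [← List.length_pos_iff]; simp at hlen; omega
          rw [hrec v L hL, List.drop_one, List.tail_cons]
          refine (abs_add_le _ _).trans (add_le_add_right ?_ _)
          rw [abs_div, Nat.abs_cast, div_eq_mul_inv, mul_comm, one_div]
          exact mul_le_mul_of_nonneg_left (abs_sub _ _) (by positivity)
      rw [histExp_drop hreg hd i 1
        (fun L => |X L - N L| + 1 / (n : ℝ) * (|Y L| + |X L|)) hw,
        histExp_add, histExp_const_mul, histExp_add] at h2
      have h3 : 1 / (n : ℝ) * (histExp G i (fun L => |Y L|) [w₀] +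
          histExp G i (fun L => |X L|) [w₀]) ≤
          1 / (n : ℝ) * (α + (((1 + 1 / (n : ℝ)) ^ i - 1) * (α + β) + β)) := by
        refine mul_le_mul_of_nonneg_left ?_ (by positivity)
        linarith [hY i (by omega), hXR i (by omega)]
      refine h2.trans ((add_le_add h1 h3).trans (le_of_eq ?_))
      rw [pow_succ]
      ring
  have hexp : (1 + 1 / (n : ℝ)) ^ i ≤ 3 := by
    calc (1 + 1 / (n : ℝ)) ^ i ≤ (1 + 1 / (n : ℝ)) ^ n :=
          pow_le_pow_right₀ (by have : 0 < 1 / (n : ℝ) := by positivity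
                                linarith) hi
      _ ≤ Real.exp (1 / n) ^ n := by
          refine pow_le_pow_left₀ (by positivity) ?_ _
          linarith [Real.add_one_le_exp (1 / (n : ℝ))]
      _ = Real.exp 1 := by
          rw [← Real.exp_nat_mul]; congr 1; field_simp
      _ ≤ 3 := by linarith [Real.exp_one_lt_d9]
  have h1 := hXR i hi
  have h2 := hR i hi
  have h3 : ((1 + 1 / (n : ℝ)) ^ i - 1) * (α + β) ≤ 2 * (α + β) :=
    mul_le_mul_of_nonneg_right (by linarith) (by linarith)
  linarith

/-- The expected deviation of the fraction of vertices visited `t` times. -/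
theorem histExp_abs_visitDev_le {d : ℕ} (hreg : G.IsRegularOfDegree d) (hd : 3 ≤ d) {K : ℕ}
    {ε : ℝ} (hε : 0 ≤ ε)
    (hlag : ∀ t l, IsHist G l → 2 ≤ l.length → |histExp G (K + 1) (discrepancy t) l| ≤ ε)
    (w₀ : V) {κ : ℝ} (hκ : 0 < κ)
    (hκε : 1 + 2 * (K + Fintype.card V * ε) ≤ Fintype.card V * κ ^ 2) (t i : ℕ)
    (hi : i ≤ Fintype.card V) :
    histExp G i (fun L => |visitDev t L|) [w₀] ≤ 6 * (2 ^ (t + 1) - 1) * κ := by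
  have : Nonempty V := ⟨w₀⟩
  have hw : IsHist G [w₀] := IsHist.single w₀
  have hn : 0 < Fintype.card V := Fintype.card_pos
  have hn' : (0 : ℝ) < Fintype.card V := by exact_mod_cast hn
  have hS : ∀ t, ∀ i ≤ Fintype.card V,
      histExp G i (fun L => |discSum t L| / Fintype.card V) [w₀] ≤ κ := by
    intro t i hi
    have h := histExp_abs_discSum_le hreg hd hε (hlag t) w₀ hn hκ hκε i hi
    simp only [div_eq_inv_mul]
    rw [histExp_const_mul, ← div_eq_inv_mul, div_le_iff₀ hn', mul_comm]
    exact h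
  -- The constants solve `a (t + 1) = 2 * a t + 6`, from `2α + 3β` with `β = 2κ`; the start `a 0 =
  -- 6` has room to spare.
  induction t generalizing i with
  | zero =>
    have h := histExp_abs_le_of_recursion hreg hd w₀ hn (visitDev 0) (fun _ => 0)
      (fun L => -(discSum 0 L / Fintype.card V)) le_rfl hκ.le (visitDev_singleton 0 w₀)
      (by simp [discSum]) (fun v l hl => ?_) (fun i _ => ?_) (fun i hi => ?_) i hi
    · refine h.trans ?_
      norm_num; linarith
    · rw [visitDev_zero_cons v hl, discSum_cons 0 v hl]; ring
    · simp [histExp_const hreg hd i 0 hw.ne_nil]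
    · simpa only [abs_neg, abs_div, Nat.abs_cast] using hS 0 i hi
  | succ t ih =>
    have h2 : (1 : ℝ) ≤ 2 ^ (t + 1) := one_le_pow₀ (by norm_num)
    have h := histExp_abs_le_of_recursion hreg hd w₀ hn (visitDev (t + 1)) (visitDev t)
      (fun L => discSum t L / Fintype.card V - discSum (t + 1) L / Fintype.card V)
      (α := 6 * (2 ^ (t + 1) - 1) * κ) (β := 2 * κ)
      (mul_nonneg (by linarith) hκ.le) (by linarith) (visitDev_singleton (t + 1) w₀)
      (by simp [discSum]) (fun v l hl => ?_) (fun i hi => ih i hi) (fun i hi => ?_) i hi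
    · refine h.trans (le_of_eq ?_)
      rw [pow_succ 2 (t + 1)]; ring
    · rw [visitDev_succ_cons t v hl, discSum_cons t v hl, discSum_cons (t + 1) v hl]; ring
    · have h3 := add_le_add (hS t i hi) (hS (t + 1) i hi)
      rw [← histExp_add] at h3
      refine le_trans (histExp_mono hw fun L _ _ _ => ?_) (h3.trans (le_of_eq (two_mul κ).symm))
      refine (abs_sub _ _).trans (le_of_eq ?_)
      simp only [abs_div, Nat.abs_cast]

end Evolution

/-! ### Asymptotics of the error terms and the Poisson limit. -/

section Limit

theorem sum_returnBound_le {n : ℕ} {C ρ D : ℝ} (hC : 0 ≤ C) (hD : 0 ≤ D) (hρ0 : 0 ≤ ρ)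
    (hρ1 : ρ < 1) (g K : ℕ) :
    (∑ m ∈ Finset.range K, if m + 1 < g then 0 else 1 / (n : ℝ) + C * ρ ^ (m + 1) * D) ≤
      K / n + C * D / (1 - ρ) * ρ ^ g := by
  -- Telescoping of the geometric tail; the extra power of `ρ` is the part not yet summed.
  have hgeom : ∀ K : ℕ, (∑ m ∈ Finset.range K, if m + 1 < g then 0 else ρ ^ (m + 1)) * (1 - ρ) +
      ρ ^ max g (K + 1) ≤ ρ ^ g := by
    intro K
    induction K with
    | zero =>
      simp only [Finset.range_zero, Finset.sum_empty, zero_mul, zero_add]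
      exact pow_le_pow_of_le_one hρ0 hρ1.le (le_max_left _ _)
    | succ K ih =>
      rw [Finset.sum_range_succ]
      split_ifs with h
      · rw [max_eq_left (by omega)] at ih ⊢
        linarith
      · rw [max_eq_right (by omega)] at ih ⊢
        rw [pow_succ ρ (K + 1)]
        linarith
  have h1 : (∑ m ∈ Finset.range K, if m + 1 < g then 0 else ρ ^ (m + 1)) ≤ ρ ^ g / (1 - ρ) := by
    rw [le_div_iff₀ (by linarith)]
    have := hgeom K
    have h2 : 0 ≤ ρ ^ max g (K + 1) := by positivity
    linarith
  calc (∑ m ∈ Finset.range K, if m + 1 < g then 0 else 1 / (n : ℝ) + C * ρ ^ (m + 1) * D)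
      ≤ ∑ m ∈ Finset.range K, (1 / (n : ℝ) + C * D * if m + 1 < g then 0 else ρ ^ (m + 1)) := by
        refine Finset.sum_le_sum fun m _ => ?_
        split_ifs
        · have : 0 ≤ 1 / (n : ℝ) := by positivity
          linarith
        · linarith
    _ = K / n + C * D * ∑ m ∈ Finset.range K, if m + 1 < g then 0 else ρ ^ (m + 1) := by
        rw [Finset.sum_add_distrib, ← Finset.mul_sum]; simp; ring
    _ ≤ K / n + C * D * (ρ ^ g / (1 - ρ)) := by gcongr
    _ = _ := by ring

/-- A bound on the correlation of the discrepancy with the history `√n` steps earlier. -/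
def lagBound (A B ρ : ℝ) (g : ℕ → ℕ) (n : ℕ) : ℝ :=
  A * (((n.sqrt + 1 : ℕ) : ℝ) * ρ ^ (n.sqrt + 1)) + (2 * (n.sqrt / n) + B * ρ ^ g n)

theorem tendsto_sqrt_div : Tendsto (fun n : ℕ => (n.sqrt : ℝ) / n) atTop (𝓝 0) := by
  have h1 : Tendsto (fun n : ℕ => (√(n : ℝ))⁻¹) atTop (𝓝 0) :=
    tendsto_inv_atTop_zero.comp (Real.tendsto_sqrt_atTop.comp tendsto_natCast_atTop_atTop)
  refine squeeze_zero (fun n => by positivity) (fun n => ?_) h1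
  rw [← Real.sqrt_div_self]
  exact div_le_div_of_nonneg_right Real.nat_sqrt_le_real_sqrt (Nat.cast_nonneg _)

theorem tendsto_nat_sqrt : Tendsto Nat.sqrt atTop atTop :=
  tendsto_atTop.2 fun b => (eventually_ge_atTop (b * b)).mono fun _ h => Nat.le_sqrt.2 h

theorem tendsto_lagBound (A B : ℝ) {ρ : ℝ} (hρ0 : 0 ≤ ρ) (hρ1 : ρ < 1) {g : ℕ → ℕ}
    (hg : Tendsto g atTop atTop) : Tendsto (lagBound A B ρ g) atTop (𝓝 0) := by
  have h1 : Tendsto (fun n : ℕ => ((n.sqrt + 1 : ℕ) : ℝ) * ρ ^ (n.sqrt + 1)) atTop (𝓝 0) :=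
    (tendsto_self_mul_const_pow_of_lt_one hρ0 hρ1).comp
      ((tendsto_add_atTop_nat 1).comp tendsto_nat_sqrt)
  have h2 : Tendsto (fun n => ρ ^ g n) atTop (𝓝 0) :=
    (tendsto_pow_atTop_nhds_zero_of_lt_one hρ0 hρ1).comp hg
  have h := (h1.const_mul A).add ((tendsto_sqrt_div.const_mul 2).add (h2.const_mul B))
  simp only [mul_zero, add_zero] at h
  exact h

/-- The scale of the accumulated discrepancies, relative to `n`. -/
def noiseScale (A B ρ : ℝ) (g : ℕ → ℕ) (n : ℕ) : ℝ :=
  √((1 + 2 * (n.sqrt + n * lagBound A B ρ g n)) / n)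

theorem tendsto_noiseScale (A B : ℝ) {ρ : ℝ} (hρ0 : 0 ≤ ρ) (hρ1 : ρ < 1) {g : ℕ → ℕ}
    (hg : Tendsto g atTop atTop) : Tendsto (noiseScale A B ρ g) atTop (𝓝 0) := by
  have h1 : Tendsto (fun n : ℕ => 1 / (n : ℝ) + (2 * ((n.sqrt : ℝ) / n) +
      2 * lagBound A B ρ g n)) atTop (𝓝 0) := by
    simpa using tendsto_one_div_atTop_nhds_zero_nat.add ((tendsto_sqrt_div.const_mul 2).add
      ((tendsto_lagBound A B hρ0 hρ1 hg).const_mul 2))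
  have h2 : Tendsto (fun n : ℕ => (1 + 2 * ((n.sqrt : ℝ) + n * lagBound A B ρ g n)) / n)
      atTop (𝓝 0) := by
    refine h1.congr' ((eventually_gt_atTop 0).mono fun n hn => ?_)
    have : (n : ℝ) ≠ 0 := by exact_mod_cast hn.ne'
    field_simp
  have h3 := (Real.continuous_sqrt.tendsto 0).comp h2
  rw [Real.sqrt_zero] at h3
  exact h3

theorem tendsto_binomProb (t : ℕ) :
    Tendsto (fun n => binomProb n t n) atTop
      (𝓝 (1 / (Real.exp 1 * (Nat.factorial t : ℝ)))) := by
  have h1 : Tendsto (fun n : ℕ => (n : ℝ) * (1 / (n : ℝ))) atTop (𝓝 1) :=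
    tendsto_const_nhds.congr' ((eventually_gt_atTop 0).mono fun n hn => by
      have : (n : ℝ) ≠ 0 := by exact_mod_cast hn.ne'
      field_simp)
  have h2 := ProbabilityTheory.tendsto_choose_mul_pow_of_tendsto_mul_atTop t h1
  have h3 : Real.exp (-1) * 1 ^ t / (Nat.factorial t : ℝ) =
      1 / (Real.exp 1 * (Nat.factorial t : ℝ)) := by
    rw [Real.exp_neg]; field_simp; simp
  rw [← h3]
  exact h2

end Limit

/-! ### From expectation to probability. -/

section Markov

variable {V : Type u} [Fintype V] [DecidableEq V] {G : SimpleGraph V} [DecidableRel G.Adj]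

theorem numVisitedExactly_div_card {k : ℕ} (w : Fin (k + 1) → V) (t : ℕ) :
    (numVisitedExactly w t : ℝ) / Fintype.card V = visitFrac t (toHist w) := by
  unfold visitFrac numVisitedExactly
  rw [Finset.card_filter]
  simp only [numVisits_eq_count, visitInd]
  push_cast
  rfl

/-- Markov's inequality for a function of the history of the walk. -/
theorem one_sub_le_pmfProb_nbWalk {d : ℕ} (hreg : G.IsRegularOfDegree d) (hd : 3 ≤ d) (w₀ : V)
    (k : ℕ) (f : List V → ℝ) {α : ℝ} (hα : 0 < α)
    (hf : histExp G k (fun L => |f L|) [w₀] ≤ α) (s : Set (Fin (k + 1) → V))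
    (hs : ∀ w, |f (toHist w)| ≤ √α → w ∈ s) : 1 - √α ≤ pmfProb (nbWalk G w₀ k) s := by
  classical
  have hr : 0 < √α := Real.sqrt_pos.2 hα
  have hw : IsHist G [w₀] := IsHist.single w₀
  have h1 : histExp G k (fun L => 1 + -(1 / √α) * |f L|) [w₀] ≤ pmfProb (nbWalk G w₀ k) s := by
    rw [← sum_nbWalk_mul hreg hd, pmfProb_eq_sum]
    refine Finset.sum_le_sum fun w _ => mul_le_mul_of_nonneg_left ?_ ENNReal.toReal_nonneg
    split_ifs with h
    · have : 0 ≤ 1 / √α * |f (toHist w)| := by positivity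
      linarith
    · have h2 : √α < |f (toHist w)| := by
        by_contra h3
        exact h (hs w (not_lt.1 h3))
      have h3 : 1 ≤ 1 / √α * |f (toHist w)| := by
        rw [one_div_mul_eq_div, le_div_iff₀ hr]; linarith
      linarith
  rw [histExp_add, histExp_const_mul, histExp_const hreg hd _ _ hw.ne_nil] at h1
  have h4 : 1 / √α * histExp G k (fun L => |f L|) [w₀] ≤ √α := by
    rw [one_div_mul_eq_div, div_le_iff₀ hr, Real.mul_self_sqrt hα.le]
    exact hf
  linarith

end Markov

end

/-! ### Assembly of the main theorem. -/

theorem theorem1 (d : ℕ) (hd : 3 ≤ d) (lam : ℝ) (hlam : lam < d)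
    (g : ℕ → ℕ) (hg : Tendsto g atTop atTop) (t : ℕ) :
    ∃ δ η : ℕ → ℝ, Tendsto δ atTop (𝓝 0) ∧ Tendsto η atTop (𝓝 0) ∧
      ∀ (n : ℕ) (V : Type u) [Fintype V] [DecidableEq V]
        (G : SimpleGraph V) [DecidableRel G.Adj] (μ : ℝ) (w₀ : V),
        IsNDLambda G n d μ → μ ≤ lam → (g n : ℕ∞) ≤ G.egirth →
        1 - η n ≤ pmfProb (nbWalk G w₀ n)
          {w | |(numVisitedExactly w t : ℝ) / (n : ℝ) -
            1 / (Real.exp 1 * (Nat.factorial t : ℝ))| ≤ δ n} := by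
  have hd' : (3 : ℝ) ≤ d := by exact_mod_cast hd
  obtain ⟨C, ρ, hC, hρ0, hρ1, hmix⟩ := exists_abs_edgeOp_iterate_le.{u} d hd (max lam 0)
    (le_max_right _ _) (max_lt hlam (by linarith))
  set A : ℝ := C * √d with hA
  set B : ℝ := A / (1 - ρ) with hB
  have hA0 : 0 ≤ A := by positivity
  have hB0 : 0 ≤ B := div_nonneg hA0 (by linarith)
  set κ : ℕ → ℝ := noiseScale A B ρ g with hκ
  set α : ℕ → ℝ := fun n => 6 * (2 ^ (t + 1) - 1) * κ n with hα
  have hκlim : Tendsto κ atTop (𝓝 0) := tendsto_noiseScale A B hρ0.le hρ1 hg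
  have hαlim : Tendsto (fun n => √(α n)) atTop (𝓝 0) := by
    have h1 : Tendsto α atTop (𝓝 0) := by simpa [hα] using hκlim.const_mul (6 * (2 ^ (t + 1) - 1))
    have h2 := (Real.continuous_sqrt.tendsto 0).comp h1
    rw [Real.sqrt_zero] at h2
    exact h2
  -- `δ` is the deterministic binomial bias plus the Markov threshold; the threshold `√α` makes the
  -- failure probability `√α` too.
  refine ⟨fun n => |binomProb n t n - 1 / (Real.exp 1 * (Nat.factorial t : ℝ))| + √(α n),
    fun n => √(α n), ?_, hαlim, ?_⟩
  · have h1 := ((tendsto_binomProb t).sub_const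
      (1 / (Real.exp 1 * (Nat.factorial t : ℝ)))).abs
    rw [sub_self, abs_zero] at h1
    simpa using h1.add hαlim
  intro n V _ _ G _ μ w₀ hG hμ hgirth
  have : Nonempty V := ⟨w₀⟩
  obtain rfl := hG.card_eq
  have hreg := hG.regular
  have hn : (0 : ℝ) < Fintype.card V := by exact_mod_cast Fintype.card_pos (α := V)
  have hμ0 : 0 ≤ μ := by
    obtain ⟨i, -, hi⟩ := hG.eigenvalue.1
    rw [hi]; exact abs_nonneg _
  have hmixG : EdgeMixing G d C ρ := hmix V G hreg fun m hm => by
    refine (sum_sq_neighbor_sum_le G hG (hμ.trans_lt hlam) m hm).trans ?_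
    refine mul_le_mul_of_nonneg_right ?_ (Finset.sum_nonneg fun v _ => sq_nonneg _)
    exact pow_le_pow_left₀ hμ0 (hμ.trans (le_max_left _ _)) 2
  set n := Fintype.card V with hndef
  set ε : ℝ := lagBound A B ρ g n with hε
  have hε0 : 0 ≤ ε := by rw [hε, lagBound]; positivity
  -- The lag `√n` is long enough for `ρ ^ √n` to beat the norm `√n` of the frozen profile, and short
  -- enough that `√n / n` vanishes.
  have hlag : ∀ t l, IsHist G l → 2 ≤ l.length →
      |histExp G (n.sqrt + 1) (discrepancy t) l| ≤ ε := by
    intro t l hl hlen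
    refine (abs_histExp_discrepancy_le hreg hd hC.le hρ0.le hmixG hgirth t n.sqrt hl hlen).trans ?_
    rw [hε, lagBound]
    refine add_le_add ?_ ?_
    · rw [Real.sqrt_mul (Nat.cast_nonneg _), hA]
      have h1 : √(n : ℝ) ≤ ((n.sqrt + 1 : ℕ) : ℝ) := by
        push_cast; exact Real.real_sqrt_le_nat_sqrt_succ
      calc C * ρ ^ (n.sqrt + 1) * (√d * √(n : ℝ))
          ≤ C * ρ ^ (n.sqrt + 1) * (√d * ((n.sqrt + 1 : ℕ) : ℝ)) := by gcongr
        _ = _ := by ring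
    · have h1 := sum_returnBound_le (n := n) hC.le (Real.sqrt_nonneg d) hρ0.le hρ1 (g n) n.sqrt
      rw [← hndef, hB, hA]
      linarith
  have hκ0 : 0 < κ n := by
    rw [hκ, noiseScale]
    exact Real.sqrt_pos.2 (by positivity)
  have hκε : 1 + 2 * ((n.sqrt : ℝ) + n * ε) ≤ n * κ n ^ 2 := by
    rw [hκ, noiseScale, Real.sq_sqrt (by positivity), mul_div_cancel₀ _ hn.ne']
  have hdev := histExp_abs_visitDev_le hreg hd hε0 hlag w₀ hκ0 hκε t n le_rfl
  have hα0 : 0 < α n := by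
    have h2 : (1 : ℝ) < 2 ^ (t + 1) := one_lt_pow₀ (by norm_num) (by omega)
    exact mul_pos (by linarith) hκ0
  refine one_sub_le_pmfProb_nbWalk hreg hd w₀ n (visitDev t) hα0 hdev _ fun w hw => ?_
  have hlenw : (toHist w).length - 1 = n := by simp [toHist]
  rw [visitDev, hlenw, ← numVisitedExactly_div_card, ← hndef] at hw
  refine (abs_sub_le _ (binomProb n t n) _).trans ?_
  linarith
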